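/- **Lemma (deformed full torsion).** Conventions. Let $M$ be an oriented smooth $7$-manifold. A $3$-form $\varphi$ on $M$ is *positive* if at each point it is identified, by a linear isomorphism of the tangent space with $\mathbb{R}^7$, with $\varphi_0=e^{123}+e^{145}+e^{167}+e^{246}-e^{257}-e^{347}-e^{356}$. In oriented local coordinates put $B_{ab}=\frac1{144}\varphi_{amn}\varphi_{bpq}\varphi_{rst}\hat\varepsilon^{mnpqrst}$, where $\hat\varepsilon$ is the alternating symbol with $\hat\varepsilon^{12\cdots7}=1$. A smooth positive $3$-form $\varphi$ defines a *$G_2$-structure* on the oriented manifold $M$ if its volume form $(\det B)^{1/9}\,dx^1\wedge\dots\wedge dx^7$ is positive, i.e. $\det B>0$. Its metric is $g_{ab}=(\det B)^{-1/9}B_{ab}$, with Levi-Civita connection $\nabla$ and Christoffel symbols $\Gamma_a{}^b{}_c=\frac12 g^{bd}(\partial_c g_{da}+\partial_a g_{dc}-\partial_d g_{ac})$. The Hodge star of a $3$-form $\alpha$ is given by $(*\alpha)^{mnpq}=\frac1{3!}(\det g)^{-1/2}\hat\varepsilon^{mnpqrst}\alpha_{rst}$, and $\psi=*\varphi$. The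 *full torsion tensor* of $\varphi$ is $T_a{}^m=\frac1{24}(\nabla_a\varphi_{bcd})\psi^{mbcd}$. Let $\varphi$ be a $G_2$-structure on $M$ and let $\chi$ be a $3$-form such that $\tilde\varphi=\varphi+\chi$ is also a $G_2$-structure on $M$ (in particular positive and inducing the given orientation). Let $g,\nabla,\Gamma,*,\psi,T$ be the objects associated with $\varphi$ and $\tilde g,\tilde\nabla,\tilde\Gamma,\tilde\psi,\tilde T$ those associated with $\tilde\varphi$. Untilded indices are raised with $g$, indices with a tilde are raised with $\tilde g$, and $(ab)$ is symmetrization with weight $\frac12$. Put $$s_{ab}=g_{ab}+\tfrac12\chi_{mn(a}\varphi_{b)}{}^{mn}+\tfrac18\chi_{amn}\chi_{bpq}\psi^{mnpq}+\tfrac1{24}\chi_{amn}\chi_{bpq}(*\chi)^{mnpq},$$ $$\delta\Gamma_a{}^b{}_c=\frac12\Big(\frac{\det g}{\det\tilde g}\Big)^{\frac12}\Big(\tilde g^{bd}\big(\nabla_c s_{ad}+\nabla_a s_{cd}-\nabla_d s_{ac}\big)-\frac19\big(\delta_a^b\delta_c^e+\delta_c^b\delta_a^e-\tilde g_{ac}\tilde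 g^{be}\big)\tilde g^{mn}\nabla_e s_{mn}\Big),$$ where $\tilde g^{ab}$ is the inverse of $\tilde g_{ab}$. Then, in all oriented local coordinates: 1. $\tilde T$ is characterized by $\tilde\nabla\tilde\varphi$, in that $\tilde\nabla_a\tilde\varphi_{bcd}=\tilde T_a{}^{\tilde e}\,\tilde\psi_{ebcd}$; 2. $\delta\Gamma$ is the difference of the Levi-Civita connections, $\tilde\Gamma_a{}^b{}_c=\Gamma_a{}^b{}_c+\delta\Gamma_a{}^b{}_c$; 3. the full torsion of $\tilde\varphi$ is $$\tilde T_a{}^{\tilde m}=\Big(\frac{\det g}{\det\tilde g}\Big)^{\frac12}\Big(T_a{}^m+\frac1{24}T_a{}^e\psi_{ebcd}(*\chi)^{mbcd}+\frac1{24}\psi^{mbcd}\nabla_a\chi_{bcd}+\frac1{24}(\nabla_a\chi_{bcd})(*\chi)^{mbcd}\Big)-\frac12\,\delta\Gamma_a{}^e{}_b\,\tilde\varphi_e{}^{\tilde m\tilde b}.$$ -/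

import Mathlib

open scoped Manifold ContDiff

noncomputable section

namespace G2

/-- The model space `ℝ⁷`. -/
abbrev E7 : Type := EuclideanSpace ℝ (Fin 7)

/-! ### The standard 3-form and positive 3-forms -/

/-- `e^{ijk} = eⁱ ∧ eʲ ∧ eᵏ` on `ℝ⁷`; on `(u, v, w)` it is the determinant of the `3 × 3` matrix
of the `i`-th, `j`-th, `k`-th coordinates of `u`, `v`, `w`. -/
def e3 (i j k : Fin 7) : (Fin 7 → ℝ) [⋀^Fin 3]→ₗ[ℝ] ℝ :=
  (Matrix.detRowAlternating : (Fin 3 → ℝ) [⋀^Fin 3]→ₗ[ℝ] ℝ).compLinearMap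
    (LinearMap.funLeft ℝ ℝ ![i, j, k])

/-- `φ₀ = e^{123} + e^{145} + e^{167} + e^{246} - e^{257} - e^{347} - e^{356}`
(with indices shifted to start at `0`). -/
def phi0 : (Fin 7 → ℝ) [⋀^Fin 3]→ₗ[ℝ] ℝ :=
  e3 0 1 2 + e3 0 3 4 + e3 0 5 6 + e3 1 3 5 - e3 1 4 6 - e3 2 3 6 - e3 2 4 5

/-- A 3-form on a 7-dimensional vector space `V` is positive if a linear isomorphism `V ≃ ℝ⁷`
pulls `φ₀` back to it, that is, if it lies in the `GL(7, ℝ)`-orbit of `φ₀`. -/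
def IsPositive {V : Type*} [AddCommGroup V] [Module ℝ V] (α : V [⋀^Fin 3]→ₗ[ℝ] ℝ) : Prop :=
  ∃ L : V ≃ₗ[ℝ] (Fin 7 → ℝ), α = phi0.compLinearMap L.toLinearMap

/-! ### Tensor fields in coordinates

A tensor field on a coordinate domain is given by its components. Below `f` stands for the
components `φ_{abc}` of a 3-form, `g` for the components of a metric. -/

/-- Components of a covariant 2-tensor at each point of `ℝ⁷`. -/
abbrev Field2 : Type := E7 → Matrix (Fin 7) (Fin 7) ℝ

/-- Components of a covariant 3-tensor at each point of `ℝ⁷`. -/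
abbrev Field3 : Type := E7 → Fin 7 → Fin 7 → Fin 7 → ℝ

/-- The partial derivative `∂_a F`. -/
def pd (F : E7 → ℝ) (y : E7) (a : Fin 7) : ℝ := fderiv ℝ F y (EuclideanSpace.single a 1)

/-- The alternating symbol `ε̂^{i₁ … i₇}` with `ε̂^{1 … 7} = 1`: the determinant of the matrix with
rows the standard basis vectors `e_{i₁}, …, e_{i₇}`. -/
def eps (i : Fin 7 → Fin 7) : ℝ :=
  (Matrix.of fun k l : Fin 7 => if i k = l then (1 : ℝ) else 0).det

/-- `B_{ab} = (1/144) φ_{amn} φ_{bpq} φ_{rst} ε̂^{mnpqrst}`, the components of the density-valued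
bilinear form `(1/6) (u ⌟ φ) ∧ (v ⌟ φ) ∧ φ` of a 3-form. -/
def bform (f : Field3) : Field2 := fun y => Matrix.of fun a b =>
  (1 / 144 : ℝ) * ∑ m, ∑ n, ∑ p, ∑ q, ∑ r, ∑ s, ∑ t,
    f y a m n * f y b p q * f y r s t * eps ![m, n, p, q, r, s, t]

/-- The metric `g_{ab} = (det B)^{-1/9} B_{ab}` of a positive 3-form (in coordinates in which
`det B > 0`, that is, oriented ones). -/
def metric (f : Field3) : Field2 := fun y =>
  ((bform f y).det ^ (-(1 / 9) : ℝ)) • bform f y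

/-- Christoffel symbols of the Levi-Civita connection,
`Γ_a{}^b{}_c = ½ g^{bd} (∂_c g_{da} + ∂_a g_{dc} - ∂_d g_{ac})`, as `christoffel g y a b c`. -/
def christoffel (g : Field2) (y : E7) (a b c : Fin 7) : ℝ :=
  (1 / 2 : ℝ) * ∑ d, (g y)⁻¹ b d *
    (pd (fun z => g z d a) y c + pd (fun z => g z d c) y a - pd (fun z => g z a c) y d)

/-- The covariant derivative `∇_a h_{bc}` of a 2-tensor (Levi-Civita connection of `g`). -/
def nabla2 (g h : Field2) (y : E7) (a b c : Fin 7) : ℝ :=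
  pd (fun z => h z b c) y a
    - ∑ e, (christoffel g y a e b * h y e c + christoffel g y a e c * h y b e)

/-- The covariant derivative `∇_a f_{bcd}` of a 3-tensor (Levi-Civita connection of `g`). -/
def nabla3 (g : Field2) (f : Field3) (y : E7) (a b c d : Fin 7) : ℝ :=
  pd (fun z => f z b c d) y a
    - ∑ e, (christoffel g y a e b * f y e c d + christoffel g y a e c * f y b e d
        + christoffel g y a e d * f y b c e)

/-- The Hodge dual 4-form with all indices raised by `g`:
`(*f)^{mnpq} = (1/3!) (det g)^{-1/2} ε̂^{mnpqrst} f_{rst}`. -/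
def starUp (g : Field2) (f : Field3) (y : E7) (m n p q : Fin 7) : ℝ :=
  (1 / 6 : ℝ) * (1 / Real.sqrt (g y).det) * ∑ r, ∑ s, ∑ t, eps ![m, n, p, q, r, s, t] * f y r s t

/-- The Hodge dual 4-form `(*f)_{abcd} = (*f)^{mnpq} g_{ma} g_{nb} g_{pc} g_{qd}`. -/
def hodgeStar (g : Field2) (f : Field3) (y : E7) (a b c d : Fin 7) : ℝ :=
  ∑ m, ∑ n, ∑ p, ∑ q, starUp g f y m n p q * g y m a * g y n b * g y p c * g y q d

/-- `f_a{}^{bc}`: the last two indices raised by `g`. -/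
def raise23 (g : Field2) (f : Field3) (y : E7) (a b c : Fin 7) : ℝ :=
  ∑ m, ∑ n, (g y)⁻¹ b m * (g y)⁻¹ c n * f y a m n

/-- The full torsion tensor `T_a{}^m = (1/24) (∇_a φ_{bcd}) ψ^{mbcd}`, `ψ = *φ`, of the
`G₂`-structure with 3-form `φ`; the metric, connection and Hodge star are those of `φ`. -/
def fullTorsion (f : Field3) (y : E7) (a m : Fin 7) : ℝ :=
  (1 / 24 : ℝ) * ∑ b, ∑ c, ∑ d, nabla3 (metric f) f y a b c d * starUp (metric f) f y m b c d

/-- `s_{ab} = g_{ab} + ½ χ_{mn(a} φ_{b)}{}^{mn} + ⅛ χ_{amn} χ_{bpq} ψ^{mnpq}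
  + (1/24) χ_{amn} χ_{bpq} (*χ)^{mnpq}`, with `k` the components of `χ`, and `g`, `ψ`, `*` those
of `φ`; `(a b)` is symmetrization with weight `½`. -/
def sTensor (f k : Field3) : Field2 := fun y => Matrix.of fun a b =>
  metric f y a b
    + (1 / 2 : ℝ) * ∑ m, ∑ n, (1 / 2 : ℝ) *
        (k y m n a * raise23 (metric f) f y b m n + k y m n b * raise23 (metric f) f y a m n)
    + (1 / 8 : ℝ) * ∑ m, ∑ n, ∑ p, ∑ q, k y a m n * k y b p q * starUp (metric f) f y m n p q
    + (1 / 24 : ℝ) * ∑ m, ∑ n, ∑ p, ∑ q, k y a m n * k y b p q * starUp (metric f) k y m n p q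

/-- `(det g / det g̃)^{1/2}`, with `g`, `g̃` the metrics of `φ` and `φ + χ`. -/
def detRatio (f k : Field3) (y : E7) : ℝ :=
  Real.sqrt ((metric f y).det / (metric (f + k) y).det)

/-- The Kronecker delta. -/
def kron (a b : Fin 7) : ℝ := if a = b then 1 else 0

/-- The tensor `δΓ_a{}^b{}_c` computed from `s`:
`½ (det g / det g̃)^{1/2} ( g̃^{bd} (∇_c s_{ad} + ∇_a s_{cd} - ∇_d s_{ac})
  - (1/9) (δ_a^b δ_c^e + δ_c^b δ_a^e - g̃_{ac} g̃^{be}) g̃^{mn} ∇_e s_{mn} )`,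
with `∇` the Levi-Civita connection of the undeformed metric `g`. -/
def deltaGamma (f k : Field3) (y : E7) (a b c : Fin 7) : ℝ :=
  (1 / 2 : ℝ) * detRatio f k y *
    ((∑ d, (metric (f + k) y)⁻¹ b d *
        (nabla2 (metric f) (sTensor f k) y c a d + nabla2 (metric f) (sTensor f k) y a c d
          - nabla2 (metric f) (sTensor f k) y d a c))
      - (1 / 9 : ℝ) * ∑ e, (kron a b * kron c e + kron c b * kron a e
            - metric (f + k) y a c * (metric (f + k) y)⁻¹ b e) *
          ∑ m, ∑ n, (metric (f + k) y)⁻¹ m n * nabla2 (metric f) (sTensor f k) y e m n)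

/-! ### `G₂`-structures on oriented 7-manifolds -/

section Manifold

variable {M : Type*} [TopologicalSpace M] [ChartedSpace E7 M]

/-- A set of charts of the smooth structure that covers `M` and whose transition maps have
positive Jacobian determinant: an oriented atlas, which makes `M` an oriented manifold. -/
structure IsOrientedAtlas (A : Set (OpenPartialHomeomorph M E7)) : Prop where
  subset_maximalAtlas : A ⊆ IsManifold.maximalAtlas (𝓡 7) ∞ M
  cover : ∀ x : M, ∃ e ∈ A, x ∈ e.source
  det_pos : ∀ e ∈ A, ∀ e' ∈ A, ∀ y ∈ (e.symm.trans e').source,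
    0 < (fderiv ℝ (e.symm.trans e') y).det

variable (M) in
/-- Fields of alternating 3-forms on the tangent spaces of `M` (no regularity). -/
abbrev ThreeForm : Type _ := ∀ x : M, TangentSpace (𝓡 7) x [⋀^Fin 3]→ₗ[ℝ] ℝ

/-- The coordinate vector `∂_a` of the chart `e`, at the point with coordinates `y`. -/
def coordVec (e : OpenPartialHomeomorph M E7) (y : E7) (a : Fin 7) :
    TangentSpace (𝓡 7) (e.symm y) :=
  mfderiv (𝓡 7) (𝓡 7) e.symm y (EuclideanSpace.single a (1 : ℝ) : E7)

/-- The components `φ_{abc} = φ(∂_a, ∂_b, ∂_c)` of a 3-form in the chart `e`, as functions of the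
coordinates. -/
def comps (e : OpenPartialHomeomorph M E7) (φ : ThreeForm M) : Field3 := fun y a b c =>
  φ (e.symm y) ![coordVec e y a, coordVec e y b, coordVec e y c]

/-- `φ` is (the 3-form of) a smooth `G₂`-structure on the manifold `M` oriented by the atlas `A`:
its components in charts are smooth, it is positive at every point, and the orientation it
induces is that of `M`, i.e. its volume form `(det B)^{1/9} dx¹ ∧ … ∧ dx⁷` is positive. -/
structure IsG2Structure (A : Set (OpenPartialHomeomorph M E7)) (φ : ThreeForm M) : Prop where
  smooth : ∀ e ∈ A, ∀ a b c, ContDiffOn ℝ ∞ (fun y => comps e φ y a b c) e.target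
  positive : ∀ x, IsPositive (φ x)
  oriented : ∀ e ∈ A, ∀ y ∈ e.target, 0 < (bform (comps e φ) y).det

end Manifold

end G2

end

open G2

/-! At each point the statement is linear algebra for the standard form. Positivity supplies a
matrix `P` whose columns are vectors on which φ₀ takes the components of φ as values. Then B = (det
P) PᵀP, so det B = (det P)⁹ and g = PᵀP, and det B > 0 makes P invertible with det P > 0. Identities
such as φ_{amn} φ_b^{mn} = 6 g_{ab} and φ_{bpq} ψ^{mnpq} = 4 φ_b^{mn} thus follow from finite
integer checks on φ₀.

For claim 1, differentiate φ_{bmn} φ_c^{mn} = 6 g_{bc}. Since ∇g = 0, the symmetrization in b, c of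
(∇_a φ_{bmn}) φ_c^{mn} vanishes (`IsG2Near.sum_nabla3_mul_raise23`). The 3-forms with this property
form the summand Λ³₇ of Λ³ = Λ³₁ ⊕ Λ³₇ ⊕ Λ³₂₇, that is, they are the X ⌟ ψ (`eq_interior_psiR`);
contraction with ψ recovers X with the factor 1/24, so X is the torsion.

For claim 2, expand the cubic expression B at φ + χ. The vanishing of antisymmetrization over eight
indices relates the mixed terms (`bpol_add_bpol`), and the outcome is B̃ = (det g)^{1/2} s, hence g̃
= ρ s with ρ = (det g / det g̃)^{1/2} (`IsAdapted.metric_add`). The trace of ∇g̃ determines ∂ρ, with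
the constant 1/9, and the Koszul formula for the difference of two Levi-Civita connections gives δΓ.

For claim 3, the raised Hodge star sees the metric only through its determinant, so ψ̃ = ρ (ψ + *χ)
with raised indices. Expanding ∇̃φ̃ = ∇φ + ∇χ - δΓ·φ̃ against it leaves the three δΓ terms, which
coincide after contraction and reduce by φ̃·ψ̃ = 4φ̃; the constant is 3·4/24 = 1/2. -/

noncomputable section

namespace G2

/-! ### The standard forms with integer components -/

/-- The Kronecker delta with integer values. -/
def kronZ (a b : Fin 7) : ℤ := if a = b then 1 else 0

/-- The components of `eⁱ ∧ eʲ ∧ eᵏ`. -/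
def e3Z (i j k a b c : Fin 7) : ℤ :=
  kronZ a i * (kronZ b j * kronZ c k - kronZ b k * kronZ c j)
    - kronZ a j * (kronZ b i * kronZ c k - kronZ b k * kronZ c i)
    + kronZ a k * (kronZ b i * kronZ c j - kronZ b j * kronZ c i)

/-- The components of the standard 3-form. -/
def phiZ (a b c : Fin 7) : ℤ :=
  e3Z 0 1 2 a b c + e3Z 0 3 4 a b c + e3Z 0 5 6 a b c + e3Z 1 3 5 a b c - e3Z 1 4 6 a b c
    - e3Z 2 3 6 a b c - e3Z 2 4 5 a b c

/-- The components of the standard 4-form. -/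
def psiZ (a b c d : Fin 7) : ℤ :=
  (∑ e, phiZ a b e * phiZ c d e) - kronZ a c * kronZ b d + kronZ a d * kronZ b c

/-- The sign of `b - a`. -/
def sgnZ (a b : Fin 7) : ℤ := if a.val < b.val then 1 else if b.val < a.val then -1 else 0

/-- The alternating symbol with integer values. -/
def epsZ (a b c d e f g : Fin 7) : ℤ :=
  sgnZ a b * (sgnZ a c * sgnZ b c) * (sgnZ a d * sgnZ b d * sgnZ c d) *
  (sgnZ a e * sgnZ b e * sgnZ c e * sgnZ d e) *
  (sgnZ a f * sgnZ b f * sgnZ c f * sgnZ d f * sgnZ e f) *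
  (sgnZ a g * sgnZ b g * sgnZ c g * sgnZ d g * sgnZ e g * sgnZ f g)

theorem sum_phiZ_mul_phiZ : ∀ a b, (∑ m, ∑ n, phiZ a m n * phiZ b m n) = 6 * kronZ a b := by
  decide +kernel

theorem sum_phiZ_mul_psiZ :
    ∀ m n b, (∑ p, ∑ q, phiZ b p q * psiZ m n p q) = 4 * phiZ b m n := by
  decide +kernel

/-- `psiZ` is defined by the contraction identity φ_{abe} φ_{cde} = δ_{ac} δ_{bd} - δ_{ad} δ_{bc} +
ψ_{abcd}; this check identifies it with the Hodge dual of φ₀, whose seven terms give the seven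
summands. -/
theorem epsZ_phiZ : ∀ m n p q,
    epsZ m n p q 0 1 2 + epsZ m n p q 0 3 4 + epsZ m n p q 0 5 6 + epsZ m n p q 1 3 5
      - epsZ m n p q 1 4 6 - epsZ m n p q 2 3 6 - epsZ m n p q 2 4 5 = psiZ m n p q := by
  decide +kernel

/-- `24` times the projection of 3-forms onto the complement of the forms `X ⌟ ψ`, corrected by
terms that vanish when the 3-form does not change the metric to first order. -/
def projZ (b c d u v w : Fin 7) : ℤ :=
  24 * (kronZ b u * kronZ c v * kronZ d w) - (∑ e, psiZ e u v w * psiZ e b c d)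
    - 3 * (kronZ b u * (∑ e, phiZ e v w * phiZ e c d) + phiZ b v w * phiZ u c d
      + (kronZ c u * (∑ e, phiZ e v w * phiZ e d b) + phiZ c v w * phiZ u d b)
      + (kronZ d u * (∑ e, phiZ e v w * phiZ e b c) + phiZ d v w * phiZ u b c))
    + 2 * (phiZ u v w * phiZ b c d)

/-- Antisymmetrization in three indices. -/
def alt3 {R : Type*} [AddCommGroup R] (F : Fin 7 → Fin 7 → Fin 7 → R) (u v w : Fin 7) : R :=
  F u v w - F v u w + F v w u - F w v u + F w u v - F u w v

/-- The algebraic core. With S_{ab} = t_{amn} φ_{bmn} + t_{bmn} φ_{amn}, it encodes for every 3-form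
t the identity 24 t_{bcd} = (t·ψ_e) ψ_{ebcd} + 3 (S_{be} φ_{ecd} + cyclic) - 2 (t·φ) φ_{bcd}. Only
the antisymmetrized coefficients matter, and increasing triples suffice, so 35 × 35 cases remain. -/
theorem alt3_projZ_of_lt : ∀ b c d, b < c → c < d → ∀ u v w, u < v → v < w →
    alt3 (projZ b c d) u v w = 0 := by
  decide +kernel

/-! ### The alternating symbol -/

theorem sum_fin_seven_arrow {R : Type*} [AddCommMonoid R] (F : (Fin 7 → Fin 7) → R) :
    ∑ i, F i = ∑ a, ∑ b, ∑ c, ∑ d, ∑ e, ∑ f, ∑ g, F ![a, b, c, d, e, f, g] := by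
  have h : ∀ (n : ℕ) (F : (Fin (n + 1) → Fin 7) → R),
      ∑ i, F i = ∑ a, ∑ j : Fin n → Fin 7, F (Matrix.vecCons a j) := by
    intro n F
    rw [← (Fin.consEquiv fun _ : Fin (n + 1) => Fin 7).sum_comp, Fintype.sum_prod_type]
    rfl
  simp only [h]
  simp [Matrix.empty_eq]

theorem det_eq_sum_prod_mul_det {ι : Type*} [Fintype ι] [DecidableEq ι] (v : Matrix ι ι ℝ) :
    v.det = ∑ i : ι → ι,
      (∏ k, v k (i k)) * (Matrix.of fun k l : ι => if i k = l then (1 : ℝ) else 0).det := by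
  have h2 := (Matrix.detRowAlternating (R := ℝ) (n := ι)).toMultilinearMap.map_sum
    (fun k l => v k l • (Pi.single l (1 : ℝ) : ι → ℝ))
  have h : (fun k => ∑ l, v k l • (Pi.single l (1 : ℝ) : ι → ℝ)) = v := by
    funext k l
    simp [Finset.sum_apply, Pi.single_apply]
  simp only [h] at h2
  refine Eq.trans h2 (Finset.sum_congr rfl fun i _ => ?_)
  rw [MultilinearMap.map_smul_univ, smul_eq_mul]
  congr 1
  simp only [Matrix.det, AlternatingMap.coe_multilinearMap]
  congr 1
  ext k l
  simp [Pi.single_apply, eq_comm]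

theorem det_eq_sum_eps (v : Matrix (Fin 7) (Fin 7) ℝ) :
    v.det = ∑ i : Fin 7 → Fin 7, (∏ k, v k (i k)) * eps i :=
  det_eq_sum_prod_mul_det v

theorem det_vecCons (u₁ u₂ u₃ u₄ u₅ u₆ u₇ : Fin 7 → ℝ) :
    Matrix.det (Matrix.of ![u₁, u₂, u₃, u₄, u₅, u₆, u₇]) = ∑ a, ∑ b, ∑ c, ∑ d, ∑ e, ∑ f, ∑ g,
      u₁ a * (u₂ b * (u₃ c * (u₄ d * (u₅ e * (u₆ f * (u₇ g * eps ![a, b, c, d, e, f, g])))))) := by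
  rw [det_eq_sum_eps, sum_fin_seven_arrow]
  refine Finset.sum_congr rfl fun a _ => Finset.sum_congr rfl fun b _ => Finset.sum_congr rfl
    fun c _ => Finset.sum_congr rfl fun d _ => Finset.sum_congr rfl fun e _ =>
    Finset.sum_congr rfl fun f _ => Finset.sum_congr rfl fun g _ => ?_
  simp [Fin.prod_univ_succ, mul_assoc]

theorem eps_comp_perm (i : Fin 7 → Fin 7) (σ : Equiv.Perm (Fin 7)) :
    eps (i ∘ σ) = (σ.sign : ℤ) * eps i := by
  have := Matrix.det_permute σ (Matrix.of fun k l : Fin 7 => if i k = l then (1 : ℝ) else 0)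
  rw [eps, eps, ← this]
  rfl

theorem eps_eq_zero {i : Fin 7 → Fin 7} {k l : Fin 7} (hkl : k ≠ l) (h : i k = i l) :
    eps i = 0 := by
  refine Matrix.det_zero_of_row_eq hkl ?_
  ext j
  simp [h]

theorem sgnZ_self (a : Fin 7) : sgnZ a a = 0 := by simp [sgnZ]

theorem sgnZ_of_ne {a b : Fin 7} (h : a ≠ b) : sgnZ a b = if a < b then 1 else -1 := by
  have : a.val ≠ b.val := fun h' => h (Fin.ext h')
  unfold sgnZ
  by_cases h1 : a.val < b.val
  · simp [h1, Fin.lt_def]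
  · have : b.val < a.val := by omega
    simp [h1, this, Fin.lt_def]

theorem eps_perm (σ : Equiv.Perm (Fin 7)) : eps σ = (σ.sign : ℤ) := by
  have h := eps_comp_perm id σ
  have h1 : eps id = 1 := by
    have : (Matrix.of fun k l : Fin 7 => if id k = l then (1 : ℝ) else 0) = 1 := by
      ext k l; simp [Matrix.one_apply]
    rw [eps, this, Matrix.det_one]
  simpa [h1] using h

/-- Replaces a real determinant by an integer expression that can be evaluated. On permutations both
sides are the sign, as a product over pairs of the order of the images; with a repeated index both
vanish. -/
theorem eps_eq_epsZ (i : Fin 7 → Fin 7) :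
    eps i = (epsZ (i 0) (i 1) (i 2) (i 3) (i 4) (i 5) (i 6) : ℤ) := by
  by_cases hi : Function.Injective i
  · obtain ⟨σ, rfl⟩ : ∃ σ : Equiv.Perm (Fin 7), i = σ :=
      ⟨Equiv.ofBijective i (Finite.injective_iff_bijective.mp hi), rfl⟩
    have h : (σ.sign : ℤ) = ∏ l, ∏ k ∈ Finset.Iio l, sgnZ (σ k) (σ l) := by
      rw [Equiv.Perm.sign_eq_prod_prod_Iio]
      push_cast
      refine Finset.prod_congr rfl fun l _ => Finset.prod_congr rfl fun k hk => ?_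
      rw [sgnZ_of_ne (σ.injective.ne (Finset.mem_Iio.mp hk).ne)]
      split_ifs <;> simp
    have h0 : Finset.Iio (0 : Fin 7) = ∅ := by decide
    have h1 : Finset.Iio (1 : Fin 7) = {0} := by decide
    have h2 : Finset.Iio (2 : Fin 7) = {0, 1} := by decide
    have h3 : Finset.Iio (3 : Fin 7) = {0, 1, 2} := by decide
    have h4 : Finset.Iio (4 : Fin 7) = {0, 1, 2, 3} := by decide
    have h5 : Finset.Iio (5 : Fin 7) = {0, 1, 2, 3, 4} := by decide
    have h6 : Finset.Iio (6 : Fin 7) = {0, 1, 2, 3, 4, 5} := by decide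
    rw [eps_perm, h, Fin.prod_univ_seven, h0, h1, h2, h3, h4, h5, h6]
    simp [epsZ, mul_assoc]
  · simp only [Function.Injective, not_forall] at hi
    obtain ⟨k, l, h, hkl⟩ := hi
    rw [eps_eq_zero hkl h]
    symm
    rw [Int.cast_eq_zero]
    have key : ∀ k l : Fin 7, k ≠ l → i k = i l →
        epsZ (i 0) (i 1) (i 2) (i 3) (i 4) (i 5) (i 6) = 0 := by
      intro k l
      fin_cases k <;> fin_cases l <;> intro hkl h <;>
        first
          | exact absurd rfl hkl
          | (simp only [Fin.reduceFinMk, Fin.isValue, Fin.zero_eta, Fin.mk_one] at h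
             simp [epsZ, h, sgnZ_self])
    exact key k l hkl h

/-! ### Finite sums -/

section Sums

variable {R : Type*} [AddCommMonoid R] {α β γ δ ε ζ η : Type*} [Fintype α] [Fintype β]
  [Fintype γ] [Fintype δ] [Fintype ε] [Fintype ζ] [Fintype η]

theorem sum_comm_one_two (F : α → β → γ → R) :
    ∑ a, ∑ b, ∑ c, F a b c = ∑ b, ∑ c, ∑ a, F a b c := by
  rw [Finset.sum_comm]
  exact Finset.sum_congr rfl fun b _ => Finset.sum_comm

theorem sum_comm_one_three (F : α → β → γ → δ → R) :
    ∑ a, ∑ b, ∑ c, ∑ d, F a b c d = ∑ b, ∑ c, ∑ d, ∑ a, F a b c d := by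
  rw [Finset.sum_comm]
  exact Finset.sum_congr rfl fun b _ => sum_comm_one_two _

theorem sum_comm_two_two (F : α → β → γ → δ → R) :
    ∑ a, ∑ b, ∑ c, ∑ d, F a b c d = ∑ c, ∑ d, ∑ a, ∑ b, F a b c d := by
  rw [← sum_comm_one_two fun a c d => ∑ b, F a b c d]
  exact Finset.sum_congr rfl fun a _ => sum_comm_one_two _

theorem sum_comm_reverse (F : α → β → γ → δ → R) :
    ∑ a, ∑ b, ∑ c, ∑ d, F a b c d = ∑ d, ∑ c, ∑ b, ∑ a, F a b c d := by
  rw [sum_comm_two_two, Finset.sum_comm]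
  exact Finset.sum_congr rfl fun d _ => Finset.sum_congr rfl fun c _ => Finset.sum_comm

theorem sum_comm_two_three (F : α → β → γ → δ → ε → R) :
    ∑ a, ∑ b, ∑ c, ∑ d, ∑ e, F a b c d e = ∑ c, ∑ d, ∑ e, ∑ a, ∑ b, F a b c d e := by
  rw [← sum_comm_one_three fun a c d e => ∑ b, F a b c d e]
  exact Finset.sum_congr rfl fun a _ => sum_comm_one_three _

theorem sum_comm_three_three (F : α → β → γ → δ → ε → ζ → R) :
    ∑ a, ∑ b, ∑ c, ∑ d, ∑ e, ∑ f, F a b c d e f = ∑ d, ∑ e, ∑ f, ∑ a, ∑ b, ∑ c, F a b c d e f := by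
  rw [← sum_comm_one_three fun a d e f => ∑ b, ∑ c, F a b c d e f]
  exact Finset.sum_congr rfl fun a _ => sum_comm_two_three _

theorem sum_comm_three_four (F : α → β → γ → δ → ε → ζ → η → R) :
    ∑ a, ∑ b, ∑ c, ∑ d, ∑ e, ∑ f, ∑ g, F a b c d e f g =
      ∑ d, ∑ e, ∑ f, ∑ g, ∑ a, ∑ b, ∑ c, F a b c d e f g := by
  rw [sum_comm_three_three]
  exact Finset.sum_congr rfl fun d _ => Finset.sum_congr rfl fun e _ =>
    Finset.sum_congr rfl fun f _ => (sum_comm_one_three fun g a b c => F a b c d e f g).symm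

end Sums

/-! ### Alternating arrays -/

/-- The components of an alternating 3-form. -/
structure IsAlt3 {R : Type*} [AddCommGroup R] (t : Fin 7 → Fin 7 → Fin 7 → R) : Prop where
  swap12 : ∀ a b c, t b a c = -t a b c
  swap23 : ∀ a b c, t a c b = -t a b c

namespace IsAlt3

variable {t : Fin 7 → Fin 7 → Fin 7 → ℝ}

theorem rotate (h : IsAlt3 t) (a b c : Fin 7) : t b c a = t a b c := by
  rw [h.swap23, h.swap12, neg_neg]

/-- Sorting the indices changes only the sign, and a repeated index gives zero. -/
theorem eq_zero (h : IsAlt3 t) (h0 : ∀ a b c, a < b → b < c → t a b c = 0) (a b c : Fin 7) :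
    t a b c = 0 := by
  have h1 : ∀ a c, t a a c = 0 := fun a c => by linarith [h.swap12 a a c]
  have h2 : ∀ a c, t a c c = 0 := fun a c => by linarith [h.swap23 a c c]
  have h3 : ∀ a c, t a c a = 0 := fun a c => by linarith [h.swap23 a a c, h1 a c]
  have h4 : ∀ a b c, t c b a = -t a b c := fun a b c => by
    rw [h.swap12 b c a, h.rotate a b c]
  rcases lt_trichotomy a b with hab | rfl | hab
  · rcases lt_trichotomy b c with hbc | rfl | hbc
    · exact h0 a b c hab hbc
    · exact h2 a b
    · rcases lt_trichotomy a c with hac | rfl | hac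
      · rw [h.swap23 a c b, h0 a c b hac hbc, neg_zero]
      · exact h3 a b
      · rw [h.rotate c a b, h0 c a b hac hab]
  · exact h1 a c
  · rcases lt_trichotomy a c with hac | rfl | hac
    · rw [h.swap12 b a c, h0 b a c hab hac, neg_zero]
    · exact h3 a b
    · rcases lt_trichotomy b c with hbc | rfl | hbc
      · rw [← h.rotate a b c, h0 b c a hbc hac]
      · exact h2 a b
      · rw [h4 c b a, h0 c b a hbc hab, neg_zero]

end IsAlt3

theorem isAlt3_alt3 {R : Type*} [AddCommGroup R] (F : Fin 7 → Fin 7 → Fin 7 → R) :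
    IsAlt3 (alt3 F) :=
  ⟨fun a b c => by simp only [alt3]; abel, fun a b c => by simp only [alt3]; abel⟩

/-- Each of the six permuted sums is brought back to the original by renaming indices, and its sign
is absorbed by `t`: an alternating array only sees the alternating part of what it is paired with.
-/
theorem sum_alt3_mul {t : Fin 7 → Fin 7 → Fin 7 → ℝ} (h : IsAlt3 t)
    (F : Fin 7 → Fin 7 → Fin 7 → ℝ) :
    ∑ u, ∑ v, ∑ w, alt3 F u v w * t u v w = 6 * ∑ u, ∑ v, ∑ w, F u v w * t u v w := by
  have e1 : ∑ u, ∑ v, ∑ w, F v u w * t u v w = -∑ u, ∑ v, ∑ w, F u v w * t u v w := by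
    rw [Finset.sum_comm]
    simp only [← Finset.sum_neg_distrib]
    refine Finset.sum_congr rfl fun u _ => Finset.sum_congr rfl fun v _ =>
      Finset.sum_congr rfl fun w _ => ?_
    rw [h.swap12 u v w]; ring
  have e2 : ∑ u, ∑ v, ∑ w, F u w v * t u v w = -∑ u, ∑ v, ∑ w, F u v w * t u v w := by
    simp only [← Finset.sum_neg_distrib]
    refine Finset.sum_congr rfl fun u _ => ?_
    rw [Finset.sum_comm]
    refine Finset.sum_congr rfl fun v _ => Finset.sum_congr rfl fun w _ => ?_
    rw [h.swap23 u v w]; ring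
  have e3 : ∑ u, ∑ v, ∑ w, F v w u * t u v w = ∑ u, ∑ v, ∑ w, F u v w * t u v w := by
    rw [sum_comm_one_two]
    refine Finset.sum_congr rfl fun u _ => Finset.sum_congr rfl fun v _ =>
      Finset.sum_congr rfl fun w _ => ?_
    rw [h.rotate w u v]
  have e4 : ∑ u, ∑ v, ∑ w, F w u v * t u v w = ∑ u, ∑ v, ∑ w, F u v w * t u v w := by
    rw [← sum_comm_one_two fun w u v => F w u v * t u v w]
    refine Finset.sum_congr rfl fun u _ => Finset.sum_congr rfl fun v _ =>
      Finset.sum_congr rfl fun w _ => ?_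
    rw [h.rotate u v w]
  have e5 : ∑ u, ∑ v, ∑ w, F w v u * t u v w = -∑ u, ∑ v, ∑ w, F u v w * t u v w := by
    rw [sum_comm_one_two, Finset.sum_comm]
    simp only [← Finset.sum_neg_distrib]
    refine Finset.sum_congr rfl fun u _ => Finset.sum_congr rfl fun v _ =>
      Finset.sum_congr rfl fun w _ => ?_
    rw [h.swap12 v w u, h.rotate u v w]; ring
  simp only [alt3, add_mul, sub_mul, Finset.sum_add_distrib, Finset.sum_sub_distrib, e1, e2, e3, e4,
    e5]
  ring


/-! ### The standard forms with real components -/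

/-- The components of the standard 3-form. -/
def phiR (a b c : Fin 7) : ℝ := phiZ a b c

/-- The components of the standard 4-form. -/
def psiR (a b c d : Fin 7) : ℝ := psiZ a b c d

theorem kronZ_cast (a b : Fin 7) : (kronZ a b : ℝ) = if a = b then 1 else 0 := by
  simp [kronZ]

theorem sum_phiR_mul_phiR (a b : Fin 7) :
    ∑ m, ∑ n, phiR a m n * phiR b m n = 6 * if a = b then 1 else 0 := by
  have := sum_phiZ_mul_phiZ a b
  rw [← kronZ_cast]
  simp only [phiR]
  exact_mod_cast congrArg (Int.cast : ℤ → ℝ) this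

theorem sum_phiR_mul_psiR (m n b : Fin 7) :
    ∑ p, ∑ q, phiR b p q * psiR m n p q = 4 * phiR b m n := by
  simp only [phiR, psiR]
  exact_mod_cast congrArg (Int.cast : ℤ → ℝ) (sum_phiZ_mul_psiZ m n b)

theorem isAlt3_phiR : IsAlt3 phiR := by
  constructor <;> intro a b c <;> simp only [phiR, phiZ, e3Z] <;> push_cast <;> ring

theorem isAlt3_psiR : ∀ e, IsAlt3 (psiR e) := by
  have h : ∀ e b c d, psiZ e c b d = -psiZ e b c d ∧ psiZ e b d c = -psiZ e b c d := by
    decide +kernel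
  refine fun e => ⟨fun b c d => ?_, fun b c d => ?_⟩ <;> simp only [psiR]
  · exact_mod_cast congrArg (Int.cast : ℤ → ℝ) (h e b c d).1
  · exact_mod_cast congrArg (Int.cast : ℤ → ℝ) (h e b c d).2

theorem sum_projZ_mul {t : Fin 7 → Fin 7 → Fin 7 → ℝ} (ht : IsAlt3 t) {b c d : Fin 7}
    (hbc : b < c) (hcd : c < d) :
    ∑ u, ∑ v, ∑ w, (projZ b c d u v w : ℝ) * t u v w = 0 := by
  have h0 : ∀ u v w, alt3 (fun u v w => (projZ b c d u v w : ℝ)) u v w = 0 := by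
    refine (isAlt3_alt3 _).eq_zero fun u v w huv hvw => ?_
    have := congrArg (Int.cast : ℤ → ℝ) (alt3_projZ_of_lt b c d hbc hcd u v w huv hvw)
    simp only [alt3] at this ⊢
    exact_mod_cast this
  have := sum_alt3_mul ht fun u v w => (projZ b c d u v w : ℝ)
  simp only [h0, zero_mul, Finset.sum_const_zero] at this
  linarith

/-- A 3-form that does not change the metric of the standard 3-form to first order is
`X ⌟ ψ` for a vector `X`. -/
theorem eq_interior_psiR {t : Fin 7 → Fin 7 → Fin 7 → ℝ} (ht : IsAlt3 t)
    (hS : ∀ a b, (∑ m, ∑ n, t a m n * phiR b m n) + ∑ m, ∑ n, t b m n * phiR a m n = 0)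
    (b c d : Fin 7) :
    t b c d = (1 / 24 : ℝ) * ∑ e, (∑ u, ∑ v, ∑ w, t u v w * psiR e u v w) * psiR e b c d := by
  suffices h : ∀ b c d,
      24 * t b c d - ∑ e, (∑ u, ∑ v, ∑ w, t u v w * psiR e u v w) * psiR e b c d = 0 by
    linarith [h b c d]
  refine IsAlt3.eq_zero ⟨fun b c d => ?_, fun b c d => ?_⟩ fun b c d hbc hcd => ?_
  · simp only [ht.swap12 b c d, (isAlt3_psiR _).swap12 b c d, mul_neg, Finset.sum_neg_distrib]
    ring
  · simp only [ht.swap23 b c d, (isAlt3_psiR _).swap23 b c d, mul_neg, Finset.sum_neg_distrib]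
    ring
  have h := sum_projZ_mul ht hbc hcd
  -- The contraction S_{xe} φ_{eyz}, written as a linear functional of `t`; its three cyclic
  -- instances are the middle terms of `projZ`, and `hS` makes them vanish.
  have key : ∀ x y z, ∑ e, ((∑ m, ∑ n, t x m n * phiR e m n) + ∑ m, ∑ n, t e m n * phiR x m n)
      * phiR e y z = ∑ u, ∑ v, ∑ w, ((if x = u then 1 else 0) * (∑ e, phiR e v w * phiR e y z)
        + phiR x v w * phiR u y z) * t u v w := by
    intro x y z
    simp only [add_mul, Finset.sum_add_distrib]
    congr 1
    · simp only [ite_mul, one_mul, zero_mul, Finset.sum_ite_irrel, Finset.sum_const_zero,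
        Finset.sum_ite_eq, Finset.mem_univ, if_true, Finset.sum_mul]
      rw [sum_comm_one_two]
      refine Finset.sum_congr rfl fun u _ => Finset.sum_congr rfl fun v _ =>
        Finset.sum_congr rfl fun w _ => ?_
      ring
    · simp only [Finset.sum_mul]
      refine Finset.sum_congr rfl fun u _ => Finset.sum_congr rfl fun v _ =>
        Finset.sum_congr rfl fun w _ => ?_
      ring
  have k1 := key b c d
  have k2 := key c d b
  have k3 := key d b c
  simp only [hS, zero_mul, Finset.sum_const_zero] at k1 k2 k3
  -- The full contraction t·φ is half the trace of S, so it vanishes too.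
  have k4 : 0 = ∑ u, ∑ v, ∑ w, (phiR u v w * phiR b c d) * t u v w := by
    have : ∑ u, ∑ v, ∑ w, t u v w * phiR u v w = 0 := by
      refine Finset.sum_eq_zero fun u _ => ?_
      linarith [hS u u]
    calc (0 : ℝ) = (∑ u, ∑ v, ∑ w, t u v w * phiR u v w) * phiR b c d := by rw [this, zero_mul]
      _ = _ := by
        simp only [Finset.sum_mul]
        refine Finset.sum_congr rfl fun u _ => Finset.sum_congr rfl fun v _ =>
          Finset.sum_congr rfl fun w _ => ?_
        ring
  have k5 : ∑ e, (∑ u, ∑ v, ∑ w, t u v w * psiR e u v w) * psiR e b c d =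
      ∑ u, ∑ v, ∑ w, (∑ e, psiR e u v w * psiR e b c d) * t u v w := by
    simp only [Finset.sum_mul]
    rw [sum_comm_one_three]
    refine Finset.sum_congr rfl fun u _ => Finset.sum_congr rfl fun v _ =>
      Finset.sum_congr rfl fun w _ => Finset.sum_congr rfl fun e _ => ?_
    ring
  have k6 : t b c d = ∑ u, ∑ v, ∑ w, ((if b = u then (1 : ℝ) else 0) * (if c = v then 1 else 0) *
      (if d = w then 1 else 0)) * t u v w := by
    simp
  have hp : ∀ u v w, (projZ b c d u v w : ℝ) * t u v w =
      24 * (((if b = u then (1 : ℝ) else 0) * (if c = v then 1 else 0) *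
        (if d = w then 1 else 0)) * t u v w)
      - (∑ e, psiR e u v w * psiR e b c d) * t u v w
      - 3 * (((if b = u then 1 else 0) * (∑ e, phiR e v w * phiR e c d)
        + phiR b v w * phiR u c d) * t u v w)
      - 3 * (((if c = u then 1 else 0) * (∑ e, phiR e v w * phiR e d b)
        + phiR c v w * phiR u d b) * t u v w)
      - 3 * (((if d = u then 1 else 0) * (∑ e, phiR e v w * phiR e b c)
        + phiR d v w * phiR u b c) * t u v w)
      + 2 * ((phiR u v w * phiR b c d) * t u v w) := by
    intro u v w
    simp only [projZ, phiR, psiR, ← kronZ_cast]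
    push_cast
    ring
  simp only [hp, Finset.sum_add_distrib, Finset.sum_sub_distrib, ← Finset.mul_sum] at h
  rw [← k1, ← k2, ← k3, ← k4, ← k5, ← k6] at h
  linarith

/-! ### Covariant tensors as multilinear maps -/

/-- The trilinear form with components `t`. -/
def tri (t : Fin 7 → Fin 7 → Fin 7 → ℝ) :
    (Fin 7 → ℝ) →ₗ[ℝ] (Fin 7 → ℝ) →ₗ[ℝ] (Fin 7 → ℝ) →ₗ[ℝ] ℝ :=
  ∑ i, ∑ j, ∑ k, t i j k •
    (LinearMap.proj i).smulRight ((LinearMap.proj j).smulRight (LinearMap.proj k))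

/-- The quadrilinear form with components `t`. -/
def quad (t : Fin 7 → Fin 7 → Fin 7 → Fin 7 → ℝ) :
    (Fin 7 → ℝ) →ₗ[ℝ] (Fin 7 → ℝ) →ₗ[ℝ] (Fin 7 → ℝ) →ₗ[ℝ] (Fin 7 → ℝ) →ₗ[ℝ] ℝ :=
  ∑ i, (LinearMap.proj i).smulRight (tri (t i))

theorem tri_apply (t : Fin 7 → Fin 7 → Fin 7 → ℝ) (u v w : Fin 7 → ℝ) :
    tri t u v w = ∑ i, ∑ j, ∑ k, t i j k * (u i * (v j * w k)) := by
  simp [tri, LinearMap.sum_apply]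

theorem quad_apply (t : Fin 7 → Fin 7 → Fin 7 → Fin 7 → ℝ) (u v w x : Fin 7 → ℝ) :
    quad t u v w x = ∑ i, ∑ j, ∑ k, ∑ l, t i j k l * (u i * (v j * (w k * x l))) := by
  simp only [quad, LinearMap.sum_apply, LinearMap.smulRight_apply, LinearMap.smul_apply, tri_apply,
    LinearMap.proj_apply, smul_eq_mul, Finset.mul_sum]
  refine Finset.sum_congr rfl fun i _ => Finset.sum_congr rfl fun j _ =>
    Finset.sum_congr rfl fun k _ => Finset.sum_congr rfl fun l _ => ?_
  ring

/-- The standard basis vectors of `ℝ⁷`. -/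
def stdVec (i : Fin 7) : Fin 7 → ℝ := Pi.single i 1

theorem stdVec_apply (i j : Fin 7) : stdVec i j = if j = i then 1 else 0 := by
  simp [stdVec, Pi.single_apply]

theorem eq_sum_stdVec (u : Fin 7 → ℝ) : u = ∑ i, u i • stdVec i := by
  ext j
  simp [Finset.sum_apply, stdVec_apply]

theorem map_eq_sum {M : Type*} [AddCommMonoid M] [Module ℝ M] (L : (Fin 7 → ℝ) →ₗ[ℝ] M)
    (u : Fin 7 → ℝ) : L u = ∑ i, u i • L (stdVec i) := by
  conv_lhs => rw [eq_sum_stdVec u]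
  simp

theorem tri_stdVec (t : Fin 7 → Fin 7 → Fin 7 → ℝ) (u : Fin 7 → ℝ) (j k : Fin 7) :
    tri t u (stdVec j) (stdVec k) = ∑ i, t i j k * u i := by
  simp [tri_apply, stdVec_apply]

theorem quad_stdVec (t : Fin 7 → Fin 7 → Fin 7 → Fin 7 → ℝ) (u v : Fin 7 → ℝ) (k l : Fin 7) :
    quad t u v (stdVec k) (stdVec l) = ∑ i, ∑ j, t i j k l * (u i * v j) := by
  simp [quad_apply, stdVec_apply]

theorem sum_e3Z_mul (X : Fin 7 → Fin 7 → Fin 7 → ℝ) (i j k : Fin 7) :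
    ∑ a, ∑ b, ∑ c, (e3Z i j k a b c : ℝ) * X a b c = alt3 X i j k := by
  have h : ∀ i j k, ∑ a, ∑ b, ∑ c, (((if a = i then (1 : ℝ) else 0) * (if b = j then 1 else 0) *
      (if c = k then 1 else 0)) * X a b c) = X i j k := by
    intro i j k
    simp
  have h2 : ∀ a b c, (e3Z i j k a b c : ℝ) * X a b c =
      ((if a = i then (1 : ℝ) else 0) * (if b = j then 1 else 0) *
        (if c = k then 1 else 0)) * X a b c
      - ((if a = j then (1 : ℝ) else 0) * (if b = i then 1 else 0) *
        (if c = k then 1 else 0)) * X a b c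
      + ((if a = j then (1 : ℝ) else 0) * (if b = k then 1 else 0) *
        (if c = i then 1 else 0)) * X a b c
      - ((if a = k then (1 : ℝ) else 0) * (if b = j then 1 else 0) *
        (if c = i then 1 else 0)) * X a b c
      + ((if a = k then (1 : ℝ) else 0) * (if b = i then 1 else 0) *
        (if c = j then 1 else 0)) * X a b c
      - ((if a = i then (1 : ℝ) else 0) * (if b = k then 1 else 0) *
        (if c = j then 1 else 0)) * X a b c := by
    intro a b c
    simp only [e3Z, ← kronZ_cast]
    push_cast
    ring
  simp only [h2, Finset.sum_add_distrib, Finset.sum_sub_distrib, h, alt3]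

theorem sum_phiR_mul (X : Fin 7 → Fin 7 → Fin 7 → ℝ) :
    ∑ a, ∑ b, ∑ c, phiR a b c * X a b c = alt3 X 0 1 2 + alt3 X 0 3 4 + alt3 X 0 5 6
      + alt3 X 1 3 5 - alt3 X 1 4 6 - alt3 X 2 3 6 - alt3 X 2 4 5 := by
  simp only [phiR, phiZ, Int.cast_add, Int.cast_sub, add_mul, sub_mul, Finset.sum_add_distrib,
    Finset.sum_sub_distrib, sum_e3Z_mul]

theorem e3_apply (i j k : Fin 7) (u v w : Fin 7 → ℝ) :
    e3 i j k ![u, v, w] = alt3 (fun a b c => u a * (v b * w c)) i j k := by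
  have : e3 i j k ![u, v, w] = Matrix.det (Matrix.of fun x y => (![u, v, w] x) (![i, j, k] y)) := rfl
  rw [this, Matrix.det_fin_three]
  simp [alt3]
  ring

theorem phi0_apply (u v w : Fin 7 → ℝ) : phi0 ![u, v, w] = tri phiR u v w := by
  rw [tri_apply, sum_phiR_mul]
  simp only [phi0, AlternatingMap.add_apply, AlternatingMap.sub_apply, e3_apply]

theorem isAlt3_eps (a b c d : Fin 7) : IsAlt3 fun i j k => eps ![a, b, c, d, i, j, k] := by
  constructor <;> intro i j k
  · have := eps_comp_perm ![a, b, c, d, i, j, k] (Equiv.swap 4 5)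
    rw [Equiv.Perm.sign_swap (by decide)] at this
    simp only [Units.val_neg, Units.val_one, Int.cast_neg, Int.cast_one, neg_mul, one_mul] at this
    rw [← this]
    congr 1
    ext x
    fin_cases x <;> rfl
  · have := eps_comp_perm ![a, b, c, d, i, j, k] (Equiv.swap 5 6)
    rw [Equiv.Perm.sign_swap (by decide)] at this
    simp only [Units.val_neg, Units.val_one, Int.cast_neg, Int.cast_one, neg_mul, one_mul] at this
    rw [← this]
    congr 1
    ext x
    fin_cases x <;> rfl

theorem IsAlt3.alt3_eq {t : Fin 7 → Fin 7 → Fin 7 → ℝ} (h : IsAlt3 t) (a b c : Fin 7) :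
    alt3 t a b c = 6 * t a b c := by
  have h1 := h.swap12 a b c
  have h2 := h.swap23 a b c
  have h3 := h.rotate a b c
  have h4 := h.rotate c a b
  have h5 := h.rotate a c b
  simp only [alt3]
  linarith

theorem sum_phiR_mul_eps (a b c d : Fin 7) :
    ∑ i, ∑ j, ∑ k, phiR i j k * eps ![a, b, c, d, i, j, k] = 6 * psiR a b c d := by
  rw [sum_phiR_mul, psiR, ← epsZ_phiZ]
  rw [(isAlt3_eps a b c d).alt3_eq, (isAlt3_eps a b c d).alt3_eq, (isAlt3_eps a b c d).alt3_eq,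
    (isAlt3_eps a b c d).alt3_eq, (isAlt3_eps a b c d).alt3_eq, (isAlt3_eps a b c d).alt3_eq,
    (isAlt3_eps a b c d).alt3_eq]
  simp only [eps_eq_epsZ, Matrix.cons_val]
  push_cast
  ring

/-! ### The forms in a frame -/

section Frame

open Matrix

variable {P A : Matrix (Fin 7) (Fin 7) ℝ}

/-- Contraction of a covariant with a contravariant index in a frame and its dual coframe. -/
theorem sum_frame_mul_coframe (hPA : P * A = 1) (g h : (Fin 7 → ℝ) →ₗ[ℝ] ℝ) :
    ∑ m, g (P.col m) * h (A.row m) = ∑ i, g (stdVec i) * h (stdVec i) := by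
  have h1 : ∀ m, g (P.col m) * h (A.row m) =
      ∑ i, ∑ j, (P i m * A m j) * (g (stdVec i) * h (stdVec j)) := by
    intro m
    rw [map_eq_sum g, map_eq_sum h, Finset.sum_mul_sum]
    refine Finset.sum_congr rfl fun i _ => Finset.sum_congr rfl fun j _ => ?_
    simp only [Matrix.row_apply, Matrix.col_apply, smul_eq_mul]
    ring
  simp only [h1]
  rw [sum_comm_one_two]
  simp only [← Finset.sum_mul, ← Matrix.mul_apply, hPA, Matrix.one_apply]
  simp

/-- The components of the standard 3-form in the frame given by the columns of `P`. -/
def frameForm (P : Matrix (Fin 7) (Fin 7) ℝ) (a b c : Fin 7) : ℝ := tri phiR (P.col a) (P.col b) (P.col c)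

/-- Multiplying the matrix with rows A_m, A_n, A_p, A_q, e_i, e_j, e_k by P turns it into the one
with rows e_m, e_n, e_p, e_q, P_i, P_j, P_k. Taking determinants trades three factors P on ε̂ for
four factors A and one det P. -/
theorem det_frame (hAP : A * P = 1) (m n p q i j k : Fin 7) :
    ∑ r, ∑ s, ∑ t, P i r * (P j s * (P k t * eps ![m, n, p, q, r, s, t])) =
      P.det * ∑ a, ∑ b, ∑ c, ∑ d,
        A m a * (A n b * (A p c * (A q d * eps ![a, b, c, d, i, j, k]))) := by
  have h1 : Matrix.det (Matrix.of ![stdVec m, stdVec n, stdVec p, stdVec q, P.row i, P.row j, P.row k]) =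
      ∑ r, ∑ s, ∑ t, P i r * (P j s * (P k t * eps ![m, n, p, q, r, s, t])) := by
    rw [det_vecCons]
    simp [stdVec_apply]
  have h2 : Matrix.det (Matrix.of ![A.row m, A.row n, A.row p, A.row q, stdVec i, stdVec j, stdVec k]) =
      ∑ a, ∑ b, ∑ c, ∑ d, A m a * (A n b * (A p c * (A q d * eps ![a, b, c, d, i, j, k]))) := by
    rw [det_vecCons]
    simp [stdVec_apply]
  have h3 : (Matrix.of ![A.row m, A.row n, A.row p, A.row q, stdVec i, stdVec j, stdVec k]) * P =
      Matrix.of ![stdVec m, stdVec n, stdVec p, stdVec q, P.row i, P.row j, P.row k] := by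
    have hA : ∀ x y, ∑ z, A x z * P z y = stdVec x y := by
      intro x y
      rw [← Matrix.mul_apply, hAP, Matrix.one_apply, stdVec_apply]
      simp [eq_comm]
    have hI : ∀ x y, ∑ z, stdVec x z * P z y = P x y := by
      intro x y
      simp [stdVec_apply]
    ext x y
    rw [Matrix.mul_apply]
    fin_cases x
    exacts [hA _ _, hA _ _, hA _ _, hA _ _, hI _ _, hI _ _, hI _ _]
  rw [← h1, ← h2, ← h3, Matrix.det_mul, mul_comm]

/-- The star of the frame form is the standard ψ evaluated on the dual coframe; the 6 counts the
orderings of the three contracted indices. -/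
theorem sum_eps_mul_frameForm (hAP : A * P = 1) (m n p q : Fin 7) :
    ∑ r, ∑ s, ∑ t, eps ![m, n, p, q, r, s, t] * frameForm P r s t =
      P.det * (6 * quad psiR (A.row m) (A.row n) (A.row p) (A.row q)) := by
  have h1 : ∑ r, ∑ s, ∑ t, eps ![m, n, p, q, r, s, t] * frameForm P r s t =
      ∑ i, ∑ j, ∑ k, phiR i j k *
        ∑ r, ∑ s, ∑ t, P i r * (P j s * (P k t * eps ![m, n, p, q, r, s, t])) := by
    simp only [frameForm, tri_apply, Finset.mul_sum, Matrix.col_apply]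
    rw [sum_comm_three_three]
    refine Finset.sum_congr rfl fun i _ => Finset.sum_congr rfl fun j _ =>
      Finset.sum_congr rfl fun k _ => Finset.sum_congr rfl fun r _ => Finset.sum_congr rfl fun s _ =>
      Finset.sum_congr rfl fun t _ => ?_
    ring
  rw [h1, quad_apply]
  simp only [det_frame hAP, Finset.mul_sum]
  rw [sum_comm_three_four]
  refine Finset.sum_congr rfl fun a _ => Finset.sum_congr rfl fun b _ =>
    Finset.sum_congr rfl fun c _ => Finset.sum_congr rfl fun d _ => ?_
  calc _ = P.det * ((∑ i, ∑ j, ∑ k, phiR i j k * eps ![a, b, c, d, i, j, k]) *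
        (A m a * (A n b * (A p c * A q d)))) := by
        simp only [Finset.mul_sum, Finset.sum_mul]
        refine Finset.sum_congr rfl fun i _ => Finset.sum_congr rfl fun j _ =>
          Finset.sum_congr rfl fun k _ => ?_
        ring
    _ = _ := by
        rw [sum_phiR_mul_eps]
        simp only [Matrix.row_apply]
        ring

end Frame

/-! ### Contractions of the standard forms and adapted frames -/

section

open Matrix

theorem sum_tri_mul_tri (u v : Fin 7 → ℝ) :
    ∑ i, ∑ j, tri phiR u (stdVec i) (stdVec j) * tri phiR v (stdVec i) (stdVec j) =
      6 * ∑ a, u a * v a := by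
  simp only [tri_stdVec, Finset.sum_mul_sum]
  rw [sum_comm_two_two]
  calc _ = ∑ a, ∑ b, (∑ i, ∑ j, phiR a i j * phiR b i j) * (u a * v b) := by
        simp only [Finset.sum_mul]
        refine Finset.sum_congr rfl fun a _ => Finset.sum_congr rfl fun b _ =>
          Finset.sum_congr rfl fun i _ => Finset.sum_congr rfl fun j _ => ?_
        ring
    _ = _ := by
        simp only [sum_phiR_mul_phiR, mul_assoc, ← Finset.mul_sum]
        simp

theorem sum_tri_mul_quad (u v w : Fin 7 → ℝ) :
    ∑ i, ∑ j, tri phiR u (stdVec i) (stdVec j) * quad psiR v w (stdVec i) (stdVec j) =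
      4 * tri phiR u v w := by
  simp only [tri_stdVec, quad_stdVec]
  rw [tri_apply]
  simp only [Finset.sum_mul]
  simp only [Finset.mul_sum]
  rw [sum_comm_two_three]
  refine Finset.sum_congr rfl fun a _ => Finset.sum_congr rfl fun b _ =>
    Finset.sum_congr rfl fun c _ => ?_
  calc _ = (∑ i, ∑ j, phiR a i j * psiR b c i j) * (u a * (v b * w c)) := by
        simp only [Finset.sum_mul]
        refine Finset.sum_congr rfl fun i _ => Finset.sum_congr rfl fun j _ => ?_
        ring
    _ = _ := by rw [sum_phiR_mul_psiR]; ring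

section Frame

variable {P A : Matrix (Fin 7) (Fin 7) ℝ}

theorem sum_frame_mul_coframe₂ (hPA : P * A = 1) (g h : (Fin 7 → ℝ) →ₗ[ℝ] (Fin 7 → ℝ) →ₗ[ℝ] ℝ) :
    ∑ m, ∑ n, g (P.col m) (P.col n) * h (A.row m) (A.row n) =
      ∑ i, ∑ j, g (stdVec i) (stdVec j) * h (stdVec i) (stdVec j) := by
  simp only [fun m => sum_frame_mul_coframe hPA (g (P.col m)) (h (A.row m))]
  rw [Finset.sum_comm]
  have key : ∀ j, ∑ m, g (P.col m) (stdVec j) * h (A.row m) (stdVec j) =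
      ∑ i, g (stdVec i) (stdVec j) * h (stdVec i) (stdVec j) :=
    fun j => sum_frame_mul_coframe hPA (g.flip (stdVec j)) (h.flip (stdVec j))
  simp only [key]
  rw [Finset.sum_comm]

theorem sum_frameForm_mul_quad (hPA : P * A = 1) (b : Fin 7) (v w : Fin 7 → ℝ) :
    ∑ p, ∑ q, frameForm P b p q * quad psiR v w (A.row p) (A.row q) =
      4 * tri phiR (P.col b) v w := by
  rw [← sum_tri_mul_quad]
  exact sum_frame_mul_coframe₂ hPA _ _

theorem sum_frameForm_mul_tri (hPA : P * A = 1) (a : Fin 7) (v : Fin 7 → ℝ) :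
    ∑ m, ∑ n, frameForm P a m n * tri phiR v (A.row m) (A.row n) = 6 * ∑ i, P i a * v i := by
  refine (sum_frame_mul_coframe₂ hPA (tri phiR (P.col a)) (tri phiR v)).trans ?_
  rw [sum_tri_mul_tri]
  rfl

/-- At `y`, the components `f` are those of the standard 3-form in the positively oriented frame
given by the columns of `P`; the rows of `A` are the dual frame. -/
structure IsAdapted (P A : Matrix (Fin 7) (Fin 7) ℝ) (f : Field3) (y : E7) : Prop where
  mul_eq_one : P * A = 1
  mul_eq_one' : A * P = 1
  det_pos : 0 < P.det
  eq_frameForm : ∀ a b c, f y a b c = frameForm P a b c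

/-- The constant 144 is 6·4·6: from the star, from φ·ψ = 4φ, and from φ·φ = 6δ. -/
theorem bform_eq {f : Field3} {y : E7} (hPA : P * A = 1) (hf : ∀ a b c, f y a b c = frameForm P a b c) :
    bform f y = P.det • (Pᵀ * P) := by
  have hAP : A * P = 1 := mul_eq_one_comm.mp hPA
  ext a b
  have h1 : bform f y a b = (1 / 144 : ℝ) * ∑ m, ∑ n, ∑ p, ∑ q, frameForm P a m n *
      (frameForm P b p q * ∑ r, ∑ s, ∑ t, eps ![m, n, p, q, r, s, t] * frameForm P r s t) := by
    simp only [bform, Matrix.of_apply, hf, Finset.mul_sum]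
    refine Finset.sum_congr rfl fun m _ => Finset.sum_congr rfl fun n _ =>
      Finset.sum_congr rfl fun p _ => Finset.sum_congr rfl fun q _ =>
      Finset.sum_congr rfl fun r _ => Finset.sum_congr rfl fun s _ =>
      Finset.sum_congr rfl fun t _ => ?_
    ring
  have h2 : ∀ m n p q, frameForm P a m n * (frameForm P b p q *
      (P.det * (6 * quad psiR (A.row m) (A.row n) (A.row p) (A.row q)))) =
      6 * P.det * (frameForm P a m n *
        (frameForm P b p q * quad psiR (A.row m) (A.row n) (A.row p) (A.row q))) := by
    intros; ring
  have h3 : ∀ m n, frameForm P a m n * (4 * tri phiR (P.col b) (A.row m) (A.row n)) =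
      4 * (frameForm P a m n * tri phiR (P.col b) (A.row m) (A.row n)) := by
    intros; ring
  rw [h1]
  simp only [sum_eps_mul_frameForm hAP, h2, ← Finset.mul_sum]
  simp only [sum_frameForm_mul_quad hPA, h3, ← Finset.mul_sum]
  rw [sum_frameForm_mul_tri hPA, Matrix.smul_apply, Matrix.mul_apply]
  simp only [Matrix.col_apply, Matrix.transpose_apply, smul_eq_mul]
  ring

/-- The vectors `p a` need not be known to be independent: a linear relation among them would be a
null vector of B, against det B > 0. Once P is invertible, det B = (det P)⁹ is positive, and the odd
exponent gives det P > 0. -/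
theorem exists_isAdapted {f : Field3} {y : E7} (p : Fin 7 → Fin 7 → ℝ)
    (hf : ∀ a b c, f y a b c = phi0 ![p a, p b, p c]) (hB : 0 < (bform f y).det) :
    ∃ P A, IsAdapted P A f y := by
  obtain ⟨P, hP⟩ : ∃ P : Matrix (Fin 7) (Fin 7) ℝ, P = (Matrix.of p)ᵀ := ⟨_, rfl⟩
  have hf' : ∀ a b c, f y a b c = frameForm P a b c := by
    intro a b c
    rw [hf, phi0_apply, hP]
    rfl
  have hdet : P.det ≠ 0 := by
    intro h0
    obtain ⟨c, hc, hPc⟩ := Matrix.exists_mulVec_eq_zero_iff.mpr h0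
    have h1 : ∑ a, c a • P.col a = 0 := by
      rw [← hPc]
      ext i
      simp [Matrix.mulVec, dotProduct, Finset.sum_apply, mul_comm]
    have h2 : ∀ m n, ∑ a, c a * f y a m n = 0 := by
      intro m n
      have := congrArg (fun u => tri phiR u (P.col m) (P.col n)) h1
      simpa [map_sum, LinearMap.sum_apply, hf', frameForm] using this
    refine hB.ne' (Matrix.exists_vecMul_eq_zero_iff.mp ⟨c, hc, ?_⟩)
    ext b
    simp only [Matrix.vecMul, dotProduct, bform, Matrix.of_apply, Pi.zero_apply]
    calc _ = (1 / 144 : ℝ) * ∑ m, ∑ n, (∑ a, c a * f y a m n) * ∑ p, ∑ q, ∑ r, ∑ s, ∑ t,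
          f y b p q * f y r s t * eps ![m, n, p, q, r, s, t] := by
          simp only [Finset.sum_mul]
          rw [← sum_comm_one_two, Finset.mul_sum]
          refine Finset.sum_congr rfl fun a _ => ?_
          simp only [Finset.mul_sum]
          refine Finset.sum_congr rfl fun m _ => Finset.sum_congr rfl fun n _ =>
            Finset.sum_congr rfl fun p _ => Finset.sum_congr rfl fun q _ =>
            Finset.sum_congr rfl fun r _ => Finset.sum_congr rfl fun s _ =>
            Finset.sum_congr rfl fun t _ => ?_
          ring
      _ = 0 := by simp [h2]
  have hu : IsUnit P.det := isUnit_iff_ne_zero.mpr hdet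
  refine ⟨P, P⁻¹, Matrix.mul_nonsing_inv _ hu, Matrix.nonsing_inv_mul _ hu, ?_, hf'⟩
  rw [bform_eq (Matrix.mul_nonsing_inv _ hu) hf', Matrix.det_smul, Matrix.det_mul,
    Matrix.det_transpose] at hB
  have : 0 < P.det ^ 9 := by
    convert hB using 1
    simp only [Fintype.card_fin]
    ring
  exact (Odd.pow_pos_iff (by decide)).mp this

end Frame

/-! ### Metric, Hodge star and contraction identities in an adapted frame -/

namespace IsAdapted

variable {P A : Matrix (Fin 7) (Fin 7) ℝ} {f : Field3} {y : E7}

theorem metric_eq (h : IsAdapted P A f y) : metric f y = Pᵀ * P := by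
  have hB := bform_eq h.mul_eq_one h.eq_frameForm
  have hd : (bform f y).det = P.det ^ (9 : ℕ) := by
    rw [hB, Matrix.det_smul, Matrix.det_mul, Matrix.det_transpose]
    simp only [Fintype.card_fin]
    ring
  have : ((bform f y).det ^ (-(1 / 9) : ℝ)) = P.det⁻¹ := by
    rw [hd, ← Real.rpow_natCast, ← Real.rpow_mul h.det_pos.le]
    norm_num
    exact Real.rpow_neg_one _
  rw [metric, this, hB, smul_smul, inv_mul_cancel₀ h.det_pos.ne', one_smul]

theorem det_metric (h : IsAdapted P A f y) : (metric f y).det = P.det ^ 2 := by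
  rw [h.metric_eq, Matrix.det_mul, Matrix.det_transpose]
  ring

theorem sqrt_det_metric (h : IsAdapted P A f y) : Real.sqrt (metric f y).det = P.det := by
  rw [h.det_metric, Real.sqrt_sq h.det_pos.le]

theorem inv_metric (h : IsAdapted P A f y) : (metric f y)⁻¹ = A * Aᵀ := by
  refine Matrix.inv_eq_right_inv ?_
  rw [h.metric_eq]
  calc Pᵀ * P * (A * Aᵀ) = Pᵀ * (P * A) * Aᵀ := by simp only [Matrix.mul_assoc]
    _ = (A * P)ᵀ := by rw [h.mul_eq_one, Matrix.mul_one, Matrix.transpose_mul]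
    _ = 1 := by rw [h.mul_eq_one', Matrix.transpose_one]

theorem starUp_eq (h : IsAdapted P A f y) (m n p q : Fin 7) :
    starUp (metric f) f y m n p q = quad psiR (A.row m) (A.row n) (A.row p) (A.row q) := by
  simp only [starUp, h.sqrt_det_metric, h.eq_frameForm, sum_eps_mul_frameForm h.mul_eq_one']
  have := h.det_pos.ne'
  field_simp

/-- Because g = PᵀP, raising an index replaces a frame vector by the dual coframe vector;
`lowered_row` is the converse. -/
theorem raised_col (h : IsAdapted P A f y) (b : Fin 7) : ∑ m, (metric f y)⁻¹ b m • P.col m = A.row b := by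
  have : (metric f y)⁻¹ * Pᵀ = A := by
    rw [h.inv_metric, Matrix.mul_assoc, ← Matrix.transpose_mul, h.mul_eq_one,
      Matrix.transpose_one, Matrix.mul_one]
  ext i
  rw [Matrix.row_apply, ← this, Matrix.mul_apply]
  simp [Finset.sum_apply]

theorem lowered_row (h : IsAdapted P A f y) (b : Fin 7) : ∑ m, metric f y m b • A.row m = P.col b := by
  have : Aᵀ * metric f y = P := by
    rw [h.metric_eq, ← Matrix.mul_assoc, ← Matrix.transpose_mul, h.mul_eq_one,
      Matrix.transpose_one, Matrix.one_mul]
  ext i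
  rw [Matrix.col_apply, ← this, Matrix.mul_apply]
  simp [Finset.sum_apply, mul_comm]

theorem raise23_eq (h : IsAdapted P A f y) (a b c : Fin 7) :
    raise23 (metric f) f y a b c = tri phiR (P.col a) (A.row b) (A.row c) := by
  rw [← h.raised_col b, ← h.raised_col c]
  simp only [raise23, map_sum, LinearMap.sum_apply, map_smul, LinearMap.smul_apply, smul_eq_mul,
    h.eq_frameForm, frameForm, Finset.mul_sum]
  rw [Finset.sum_comm]
  refine Finset.sum_congr rfl fun m _ => Finset.sum_congr rfl fun n _ => ?_
  ring

theorem hodgeStar_eq (h : IsAdapted P A f y) (a b c d : Fin 7) :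
    hodgeStar (metric f) f y a b c d = quad psiR (P.col a) (P.col b) (P.col c) (P.col d) := by
  rw [← h.lowered_row a, ← h.lowered_row b, ← h.lowered_row c, ← h.lowered_row d]
  simp only [hodgeStar, map_sum, LinearMap.sum_apply, map_smul, LinearMap.smul_apply, smul_eq_mul,
    h.starUp_eq, Finset.mul_sum]
  rw [sum_comm_reverse]
  refine Finset.sum_congr rfl fun m _ => Finset.sum_congr rfl fun n _ =>
    Finset.sum_congr rfl fun p _ => Finset.sum_congr rfl fun q _ => ?_
  ring

theorem sum_mul_starUp (h : IsAdapted P A f y) (b m n : Fin 7) :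
    ∑ p, ∑ q, f y b p q * starUp (metric f) f y m n p q = 4 * raise23 (metric f) f y b m n := by
  simp only [h.starUp_eq, h.raise23_eq, h.eq_frameForm, sum_frameForm_mul_quad h.mul_eq_one]

theorem sum_mul_raise23 (h : IsAdapted P A f y) (a b : Fin 7) :
    ∑ m, ∑ n, f y a m n * raise23 (metric f) f y b m n = 6 * metric f y a b := by
  simp only [h.raise23_eq, h.eq_frameForm, sum_frameForm_mul_tri h.mul_eq_one, h.metric_eq,
    Matrix.mul_apply, Matrix.col_apply, Matrix.transpose_apply]

theorem bform_eq_sqrt_smul (h : IsAdapted P A f y) : bform f y = Real.sqrt (metric f y).det • metric f y := by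
  rw [bform_eq h.mul_eq_one h.eq_frameForm, h.sqrt_det_metric, h.metric_eq]

end IsAdapted

end

section

open Matrix

/-! ### 3-forms that preserve the metric to first order -/

theorem tri_swap12 {t : Fin 7 → Fin 7 → Fin 7 → ℝ} (ht : IsAlt3 t) (u v w : Fin 7 → ℝ) :
    tri t v u w = -tri t u v w := by
  rw [tri_apply, tri_apply, Finset.sum_comm]
  simp only [← Finset.sum_neg_distrib]
  refine Finset.sum_congr rfl fun i _ => Finset.sum_congr rfl fun j _ =>
    Finset.sum_congr rfl fun k _ => ?_
  rw [ht.swap12 i j k]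
  ring

theorem tri_swap23 {t : Fin 7 → Fin 7 → Fin 7 → ℝ} (ht : IsAlt3 t) (u v w : Fin 7 → ℝ) :
    tri t u w v = -tri t u v w := by
  rw [tri_apply, tri_apply]
  simp only [← Finset.sum_neg_distrib]
  refine Finset.sum_congr rfl fun i _ => ?_
  rw [Finset.sum_comm]
  refine Finset.sum_congr rfl fun j _ => Finset.sum_congr rfl fun k _ => ?_
  rw [ht.swap23 i j k]
  ring

theorem eq_tri (T : (Fin 7 → ℝ) →ₗ[ℝ] (Fin 7 → ℝ) →ₗ[ℝ] (Fin 7 → ℝ) →ₗ[ℝ] ℝ)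
    (u v w : Fin 7 → ℝ) :
    T u v w = tri (fun i j k => T (stdVec i) (stdVec j) (stdVec k)) u v w := by
  rw [tri_apply, map_eq_sum T u]
  simp only [LinearMap.sum_apply, LinearMap.smul_apply]
  refine Finset.sum_congr rfl fun i _ => ?_
  rw [map_eq_sum (T (stdVec i)) v]
  simp only [LinearMap.sum_apply, LinearMap.smul_apply, smul_eq_mul, Finset.mul_sum]
  refine Finset.sum_congr rfl fun j _ => ?_
  rw [map_eq_sum (T (stdVec i) (stdVec j)) w]
  simp only [smul_eq_mul, Finset.mul_sum]
  refine Finset.sum_congr rfl fun k _ => ?_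
  ring

theorem sum_smul_col {P A : Matrix (Fin 7) (Fin 7) ℝ} (h : A * P = 1) (a : Fin 7) :
    ∑ i, P i a • A.col i = stdVec a := by
  ext b
  have : ∑ i, A b i * P i a = (1 : Matrix (Fin 7) (Fin 7) ℝ) b a := by rw [← h, Matrix.mul_apply]
  simp only [Finset.sum_apply, Pi.smul_apply, Matrix.col_apply, smul_eq_mul, stdVec_apply]
  rw [← Matrix.one_apply, ← this]
  exact Finset.sum_congr rfl fun i _ => mul_comm _ _

namespace IsAdapted

variable {P A : Matrix (Fin 7) (Fin 7) ℝ} {f : Field3} {y : E7}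

/-- Transport of `eq_interior_psiR` to an arbitrary adapted frame: `t₀` is `t` expressed in the
orthonormal basis, and every contraction becomes a sum over standard basis vectors by frame–coframe
duality. -/
theorem eq_interior (h : IsAdapted P A f y) {t : Fin 7 → Fin 7 → Fin 7 → ℝ} (ht : IsAlt3 t)
    (hS : ∀ a b, (∑ m, ∑ n, t a m n * raise23 (metric f) f y b m n) +
      ∑ m, ∑ n, t b m n * raise23 (metric f) f y a m n = 0) (b c d : Fin 7) :
    t b c d = ∑ l, ((1 / 24 : ℝ) * ∑ m, ∑ n, ∑ p, t m n p * starUp (metric f) f y l m n p) *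
      hodgeStar (metric f) f y l b c d := by
  obtain ⟨t₀, ht₀⟩ : ∃ t₀ : Fin 7 → Fin 7 → Fin 7 → ℝ,
    ∀ i j k, t₀ i j k = tri t (A.col i) (A.col j) (A.col k) := ⟨_, fun _ _ _ => rfl⟩
  have halt : IsAlt3 t₀ :=
    ⟨fun i j k => by rw [ht₀, ht₀, tri_swap12 ht], fun i j k => by rw [ht₀, ht₀, tri_swap23 ht]⟩
  have htt : ∀ a b c, tri t₀ (P.col a) (P.col b) (P.col c) = t a b c := by
    intro a b c
    have h1 : t a b c = tri t (stdVec a) (stdVec b) (stdVec c) := by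
      simp [tri_apply, stdVec_apply]
    rw [h1, ← sum_smul_col h.mul_eq_one' a, ← sum_smul_col h.mul_eq_one' b,
      ← sum_smul_col h.mul_eq_one' c, tri_apply]
    simp only [map_sum, LinearMap.sum_apply, map_smul, LinearMap.smul_apply, smul_eq_mul, ht₀,
      Finset.mul_sum, Matrix.col_apply]
    rw [sum_comm_one_two, Finset.sum_comm]
    refine Finset.sum_congr rfl fun k _ => Finset.sum_congr rfl fun j _ =>
      Finset.sum_congr rfl fun i _ => ?_
    ring
  have hU : ∃ U : (Fin 7 → ℝ) →ₗ[ℝ] (Fin 7 → ℝ) →ₗ[ℝ] ℝ, ∀ u v, U u v =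
      ∑ m, ∑ n, tri t₀ u (stdVec m) (stdVec n) * tri phiR v (stdVec m) (stdVec n) := by
    refine ⟨∑ m, ∑ n, (((tri t₀).flip (stdVec m)).flip (stdVec n)).smulRight
      (((tri phiR).flip (stdVec m)).flip (stdVec n)), fun u v => ?_⟩
    simp [LinearMap.sum_apply]
  obtain ⟨U, hU⟩ := hU
  have hUP : ∀ a b, U (P.col a) (P.col b) = ∑ m, ∑ n, t a m n * raise23 (metric f) f y b m n := by
    intro a b
    rw [hU, ← sum_frame_mul_coframe₂ h.mul_eq_one]
    simp only [htt, h.raise23_eq]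
  have hUS : ∀ a b, U (P.col a) (P.col b) + U (P.col b) (P.col a) = 0 := by
    intro a b
    rw [hUP, hUP, hS]
  -- A bilinear form that vanishes on the columns of P vanishes identically, since they span.
  have hU0 : ∀ i j, (U + U.flip) (stdVec i) (stdVec j) = 0 := by
    intro i j
    have h1 : ∀ a b, (U + U.flip) (P.col a) (P.col b) = 0 := hUS
    rw [← sum_smul_col h.mul_eq_one i, ← sum_smul_col h.mul_eq_one j]
    simp only [map_sum, LinearMap.sum_apply, map_smul, LinearMap.smul_apply, h1, smul_zero,
      Finset.sum_const_zero]
  have hS₀ : ∀ a b, (∑ m, ∑ n, t₀ a m n * phiR b m n) + ∑ m, ∑ n, t₀ b m n * phiR a m n = 0 := by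
    intro a b
    have h1 : ∀ a b, U (stdVec a) (stdVec b) = ∑ m, ∑ n, t₀ a m n * phiR b m n := by
      intro a b
      rw [hU]
      simp [tri_stdVec, stdVec_apply]
    rw [← h1, ← h1]
    exact hU0 a b
  have hX : ∃ X : (Fin 7 → ℝ) →ₗ[ℝ] ℝ, ∀ x, X x =
      ∑ u, ∑ v, ∑ w, t₀ u v w * quad psiR x (stdVec u) (stdVec v) (stdVec w) := by
    refine ⟨∑ u, ∑ v, ∑ w, t₀ u v w •
      (((quad psiR).flip (stdVec u)).flip (stdVec v)).flip (stdVec w), fun x => ?_⟩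
    simp [LinearMap.sum_apply]
  obtain ⟨X, hX⟩ := hX
  have hXA : ∀ x, X x = ∑ m, ∑ n, ∑ p, t m n p * quad psiR x (A.row m) (A.row n) (A.row p) := by
    intro x
    rw [hX]
    have h1 : ∀ m n p, quad psiR x (A.row m) (A.row n) (A.row p) = ∑ u, ∑ v, ∑ w,
        quad psiR x (stdVec u) (stdVec v) (stdVec w) * (A m u * (A n v * A p w)) := by
      intro m n p
      rw [eq_tri (quad psiR x), tri_apply]
      rfl
    simp only [ht₀, h1, tri_apply, Finset.sum_mul]
    simp only [Finset.mul_sum]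
    rw [sum_comm_three_three]
    refine Finset.sum_congr rfl fun m _ => Finset.sum_congr rfl fun n _ =>
      Finset.sum_congr rfl fun p _ => Finset.sum_congr rfl fun u _ =>
      Finset.sum_congr rfl fun v _ => Finset.sum_congr rfl fun w _ => ?_
    simp only [Matrix.col_apply]
    ring
  have hY : ∃ Y : (Fin 7 → ℝ) →ₗ[ℝ] ℝ, ∀ x, Y x = quad psiR x (P.col b) (P.col c) (P.col d) :=
    ⟨(((quad psiR).flip (P.col b)).flip (P.col c)).flip (P.col d), fun x => rfl⟩
  obtain ⟨Y, hY⟩ := hY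
  have hR : ∑ l, ((1 / 24 : ℝ) * ∑ m, ∑ n, ∑ p, t m n p * starUp (metric f) f y l m n p) *
      hodgeStar (metric f) f y l b c d = (1 / 24 : ℝ) * ∑ e, Y (stdVec e) * X (stdVec e) := by
    rw [← sum_frame_mul_coframe h.mul_eq_one, Finset.mul_sum]
    refine Finset.sum_congr rfl fun l _ => ?_
    rw [hXA, hY, h.hodgeStar_eq]
    simp only [h.starUp_eq]
    ring
  rw [hR, ← htt b c d, tri_apply]
  have hXe : ∀ e, X (stdVec e) = ∑ u, ∑ v, ∑ w, t₀ u v w * psiR e u v w := by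
    intro e
    rw [hX]
    simp [stdVec_apply, quad_apply]
  have hYe : ∀ e, Y (stdVec e) = ∑ i, ∑ j, ∑ k, psiR e i j k *
      (P.col b i * (P.col c j * P.col d k)) := by
    intro e
    rw [hY]
    simp [stdVec_apply, quad_apply]
  have h0 : ∀ i j k, t₀ i j k = (1 / 24 : ℝ) * ∑ e, X (stdVec e) * psiR e i j k := by
    intro i j k
    simp only [hXe]
    exact eq_interior_psiR halt hS₀ i j k
  simp only [hYe, Finset.sum_mul, Finset.mul_sum]
  rw [sum_comm_one_three]
  refine Finset.sum_congr rfl fun i _ => Finset.sum_congr rfl fun j _ =>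
    Finset.sum_congr rfl fun k _ => ?_
  rw [h0, Finset.mul_sum, Finset.sum_mul]
  refine Finset.sum_congr rfl fun e _ => ?_
  ring

end IsAdapted

end

section

open Matrix

/-! ### The polarized density-valued bilinear form -/

/-- `x_{amn} y_{bpq} z_{rst} ε̂^{mnpqrst}`. -/
def bpol (x y z : Fin 7 → Fin 7 → Fin 7 → ℝ) (a b : Fin 7) : ℝ :=
  ∑ i : Fin 7 → Fin 7, x a (i 0) (i 1) * y b (i 2) (i 3) * z (i 4) (i 5) (i 6) * eps i

theorem bpol_eq (x y z : Fin 7 → Fin 7 → Fin 7 → ℝ) (a b : Fin 7) :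
    bpol x y z a b = ∑ m, ∑ n, ∑ p, ∑ q, ∑ r, ∑ s, ∑ t,
      x a m n * y b p q * z r s t * eps ![m, n, p, q, r, s, t] := by
  rw [bpol, sum_fin_seven_arrow]
  rfl

theorem sum_comp_perm_mul_eps (σ : Equiv.Perm (Fin 7)) (F : (Fin 7 → Fin 7) → ℝ) :
    ∑ i, F (i ∘ σ) * eps i = (σ.sign : ℤ) * ∑ i, F i * eps i := by
  have h : ∑ i, F (i ∘ σ) * eps (i ∘ σ) = ∑ i, F i * eps i :=
    (Equiv.arrowCongr σ.symm (Equiv.refl (Fin 7))).sum_comp fun i => F i * eps i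
  rw [← h, Finset.mul_sum]
  refine Finset.sum_congr rfl fun i _ => ?_
  have hs : ((σ.sign : ℤ) : ℝ) * (σ.sign : ℤ) = 1 := by
    rw [← Int.cast_mul, Int.units_coe_mul_self, Int.cast_one]
  rw [eps_comp_perm]
  linear_combination (-(F (i ∘ σ) * eps i)) * hs

/-- Exchanging the index pairs (m, n) and (p, q) is an even permutation: 2-forms commute. -/
theorem bpol_swap (x y z : Fin 7 → Fin 7 → Fin 7 → ℝ) (a b : Fin 7) :
    bpol x y z a b = bpol y x z b a := by
  have h := sum_comp_perm_mul_eps (Equiv.swap 0 2 * Equiv.swap 1 3)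
    fun i => x a (i 0) (i 1) * y b (i 2) (i 3) * z (i 4) (i 5) (i 6)
  have hs : Equiv.Perm.sign (Equiv.swap 0 2 * Equiv.swap 1 3 : Equiv.Perm (Fin 7)) = 1 := by
    decide +kernel
  rw [hs] at h
  simp only [Units.val_one, Int.cast_one, one_mul] at h
  rw [bpol, ← h, bpol]
  refine Finset.sum_congr rfl fun i _ => ?_
  have e0 : (Equiv.swap 0 2 * Equiv.swap 1 3 : Equiv.Perm (Fin 7)) 0 = 2 := by decide
  have e1 : (Equiv.swap 0 2 * Equiv.swap 1 3 : Equiv.Perm (Fin 7)) 1 = 3 := by decide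
  have e2 : (Equiv.swap 0 2 * Equiv.swap 1 3 : Equiv.Perm (Fin 7)) 2 = 0 := by decide
  have e3 : (Equiv.swap 0 2 * Equiv.swap 1 3 : Equiv.Perm (Fin 7)) 3 = 1 := by decide
  have e4 : (Equiv.swap 0 2 * Equiv.swap 1 3 : Equiv.Perm (Fin 7)) 4 = 4 := by decide
  have e5 : (Equiv.swap 0 2 * Equiv.swap 1 3 : Equiv.Perm (Fin 7)) 5 = 5 := by decide
  have e6 : (Equiv.swap 0 2 * Equiv.swap 1 3 : Equiv.Perm (Fin 7)) 6 = 6 := by decide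
  simp only [Function.comp_apply, e0, e1, e2, e3, e4, e5, e6]
  ring

/-- Antisymmetrization over eight indices in dimension seven vanishes. -/
theorem ite_mul_eps (i : Fin 7 → Fin 7) (u a : Fin 7) :
    (if u = a then 1 else 0) * eps i =
      ∑ k, if i k = a then eps (Function.update i k u) else 0 := by
  -- Cramer's rule for the transposed selection matrix and the vector e_u: the k-th Cramer
  -- determinant has row k replaced by e_u, which is ε̂ with i_k replaced by u.
  have h := congrFun (Matrix.mulVec_cramer
    (Matrix.of fun k l : Fin 7 => if i k = l then (1 : ℝ) else 0)ᵀ (stdVec u)) a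
  simp only [Matrix.mulVec, dotProduct, Matrix.cramer_transpose_apply, Matrix.transpose_apply,
    Matrix.of_apply, Matrix.det_transpose, Pi.smul_apply, smul_eq_mul, stdVec_apply] at h
  rw [mul_comm, eps]
  simp only [eq_comm (a := u)]
  rw [← h]
  refine Finset.sum_congr rfl fun k _ => ?_
  rw [ite_mul, one_mul, zero_mul]
  congr 1
  rw [eps]
  congr 1
  ext x y
  by_cases hx : x = k
  · subst hx
    simp [stdVec_apply, eq_comm]
  · simp [hx]

/-- Change of variables: pairs (i, u) with i_k = a correspond to tuples j by writing u into slot k.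
-/
theorem sum_ite_update_mul {ι α : Type*} [Fintype ι] [DecidableEq ι] [Fintype α] [DecidableEq α]
    (k : ι) (a : α) (F : α → (ι → α) → ℝ) (G : (ι → α) → ℝ) :
    ∑ i, ∑ u, F u i * (if i k = a then G (Function.update i k u) else 0) =
      ∑ j, F (j k) (Function.update j k a) * G j := by
  simp only [mul_ite, mul_zero]
  rw [← Fintype.sum_prod_type' fun i u =>
    if i k = a then F u i * G (Function.update i k u) else 0, ← Finset.sum_filter]
  refine Finset.sum_nbij' (fun x => Function.update x.1 k x.2)
    (fun j => (Function.update j k a, j k)) ?_ ?_ ?_ ?_ ?_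
  · simp
  · simp
  · rintro ⟨i, u⟩ h
    simp only [Finset.mem_filter, Finset.mem_univ, true_and] at h
    simp [← h]
  · simp
  · rintro ⟨i, u⟩ h
    simp only [Finset.mem_filter, Finset.mem_univ, true_and] at h
    simp [← h]

theorem sum_comp_swap_mul_eps {k l : Fin 7} (hkl : k ≠ l) (F : (Fin 7 → Fin 7) → ℝ) :
    ∑ i, F (i ∘ Equiv.swap k l) * eps i = -∑ i, F i * eps i := by
  rw [sum_comp_perm_mul_eps, Equiv.Perm.sign_swap hkl]
  simp

/-- Write x_{amn} = δ_{ua} x_{umn} and let `ite_mul_eps` exchange a with each of the seven indices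
of ε̂. The two indices on x give -`bpol x y y` each, the three on the last y give `bpol y y x` each,
and the two on y_b are the remaining sums. -/
theorem three_mul_bpol {x y : Fin 7 → Fin 7 → Fin 7 → ℝ} (hx : IsAlt3 x) (hy : IsAlt3 y)
    (a b : Fin 7) :
    3 * bpol x y y a b = 3 * bpol y y x a b +
      ((∑ i : Fin 7 → Fin 7, x (i 2) (i 0) (i 1) * y b a (i 3) * y (i 4) (i 5) (i 6) * eps i) +
      ∑ i : Fin 7 → Fin 7, x (i 3) (i 0) (i 1) * y b (i 2) a * y (i 4) (i 5) (i 6) * eps i) := by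
  have h1 : bpol x y y a b = ∑ k, ∑ i, ∑ u, (x u (i 0) (i 1) * y b (i 2) (i 3) *
      y (i 4) (i 5) (i 6)) * (if i k = a then eps (Function.update i k u) else 0) := by
    rw [sum_comm_one_two]
    refine Finset.sum_congr rfl fun i _ => ?_
    simp only [← Finset.mul_sum, ← ite_mul_eps]
    simp
  simp only [sum_ite_update_mul _ a fun (u : Fin 7) (i : Fin 7 → Fin 7) => x u (i 0) (i 1) * y b (i 2) (i 3) *
      y (i 4) (i 5) (i 6)] at h1
  rw [Fin.sum_univ_seven] at h1
  simp only [Function.update_self, ne_eq, Fin.reduceEq, not_false_eq_true,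
    Function.update_of_ne] at h1
  have t0 : ∑ i : Fin 7 → Fin 7, x (i 0) a (i 1) * y b (i 2) (i 3) * y (i 4) (i 5) (i 6) * eps i =
      -bpol x y y a b := by
    rw [bpol, ← Finset.sum_neg_distrib]
    refine Finset.sum_congr rfl fun i _ => ?_
    rw [hx.swap12 a (i 0) (i 1)]
    ring
  have t1 : ∑ i : Fin 7 → Fin 7, x (i 1) (i 0) a * y b (i 2) (i 3) * y (i 4) (i 5) (i 6) * eps i =
      -bpol x y y a b := by
    rw [bpol, ← Finset.sum_neg_distrib]
    refine Finset.sum_congr rfl fun i _ => ?_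
    rw [hx.rotate a (i 1) (i 0), hx.swap23 a (i 0) (i 1)]
    ring
  have t4 : ∑ i : Fin 7 → Fin 7, x (i 4) (i 0) (i 1) * y b (i 2) (i 3) * y a (i 5) (i 6) * eps i =
      bpol y y x a b := by
    have h2 := sum_comp_swap_mul_eps (k := 1) (l := 6) (by decide)
      fun i => x (i 4) (i 0) (i 6) * y b (i 2) (i 3) * y a (i 5) (i 1)
    have h3 := sum_comp_swap_mul_eps (k := 0) (l := 5) (by decide)
      fun i => x (i 4) (i 5) (i 6) * y b (i 2) (i 3) * y a (i 0) (i 1)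
    simp only [Function.comp_apply, Equiv.swap_apply_def, Fin.reduceEq, if_true, if_false] at h2 h3
    rw [h2, h3, neg_neg, bpol]
    refine Finset.sum_congr rfl fun i _ => ?_
    ring
  have t5 : ∑ i : Fin 7 → Fin 7, x (i 5) (i 0) (i 1) * y b (i 2) (i 3) * y (i 4) a (i 6) * eps i =
      bpol y y x a b := by
    have h2 := sum_comp_swap_mul_eps (k := 4) (l := 5) (by decide)
      fun i => x (i 5) (i 0) (i 1) * y b (i 2) (i 3) * y (i 4) a (i 6)
    simp only [Function.comp_apply, Equiv.swap_apply_def, Fin.reduceEq, if_true, if_false] at h2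
    rw [← t4, ← neg_eq_iff_eq_neg.mpr h2, ← Finset.sum_neg_distrib]
    refine Finset.sum_congr rfl fun i _ => ?_
    rw [hy.swap12 a (i 5) (i 6)]
    ring
  have t6 : ∑ i : Fin 7 → Fin 7, x (i 6) (i 0) (i 1) * y b (i 2) (i 3) * y (i 4) (i 5) a * eps i =
      bpol y y x a b := by
    have h2 := sum_comp_swap_mul_eps (k := 4) (l := 6) (by decide)
      fun i => x (i 6) (i 0) (i 1) * y b (i 2) (i 3) * y (i 4) (i 5) a
    simp only [Function.comp_apply, Equiv.swap_apply_def, Fin.reduceEq, if_true, if_false] at h2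
    rw [← t4, ← neg_eq_iff_eq_neg.mpr h2, ← Finset.sum_neg_distrib]
    refine Finset.sum_congr rfl fun i _ => ?_
    rw [hy.rotate a (i 6) (i 5), hy.swap23 a (i 5) (i 6)]
    ring
  rw [t0, t1, t4, t5, t6] at h1
  linarith

/-- The remaining sums of `three_mul_bpol` contain y with both indices a and b, so they are
antisymmetric and cancel on symmetrization. -/
theorem bpol_add_bpol {x y : Fin 7 → Fin 7 → Fin 7 → ℝ} (hx : IsAlt3 x) (hy : IsAlt3 y)
    (a b : Fin 7) :
    bpol x y y a b + bpol y x y a b = 2 * bpol y y x a b := by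
  have h1 := three_mul_bpol hx hy a b
  have h2 := three_mul_bpol hx hy b a
  have h3 : ∀ i : Fin 7, y a b i = -y b a i := fun i => hy.swap12 b a i
  have h4 : ∀ i : Fin 7, y a i b = -y b i a := fun i => by
    rw [hy.swap23 a b i, hy.swap12 b a i, hy.swap23 b a i]
  simp only [h3, h4, mul_neg, neg_mul, Finset.sum_neg_distrib] at h2
  rw [bpol_swap x y y b a, bpol_swap y y x b a] at h2
  linarith

theorem bpol_add_left (x x' y z : Fin 7 → Fin 7 → Fin 7 → ℝ) (a b : Fin 7) :
    bpol (x + x') y z a b = bpol x y z a b + bpol x' y z a b := by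
  simp only [bpol, Pi.add_apply, add_mul, Finset.sum_add_distrib]

theorem bpol_add_middle (x y y' z : Fin 7 → Fin 7 → Fin 7 → ℝ) (a b : Fin 7) :
    bpol x (y + y') z a b = bpol x y z a b + bpol x y' z a b := by
  simp only [bpol, Pi.add_apply, add_mul, mul_add, Finset.sum_add_distrib]

theorem bpol_add_right (x y z z' : Fin 7 → Fin 7 → Fin 7 → ℝ) (a b : Fin 7) :
    bpol x y (z + z') a b = bpol x y z a b + bpol x y z' a b := by
  simp only [bpol, Pi.add_apply, add_mul, mul_add, Finset.sum_add_distrib]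

/-- The mixed terms are arranged so that x stands in the last slot, where contraction with ε̂
produces its Hodge dual; this is what makes ψ appear in `sTensor`. -/
theorem bpol_add_self {x y : Fin 7 → Fin 7 → Fin 7 → ℝ} (hx : IsAlt3 x) (hy : IsAlt3 y)
    (a b : Fin 7) :
    bpol (x + y) (x + y) (x + y) a b = bpol x x x a b +
      (3 / 2 : ℝ) * (bpol y x x a b + bpol y x x b a) + 3 * bpol y y x a b + bpol y y y a b := by
  simp only [bpol_add_left, bpol_add_middle, bpol_add_right]
  have h1 := bpol_add_bpol hx hy a b
  have h2 := bpol_add_bpol hy hx a b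
  rw [bpol_swap y x x b a]
  linarith

theorem bform_apply (f : Field3) (y : E7) (a b : Fin 7) :
    bform f y a b = (1 / 144 : ℝ) * bpol (f y) (f y) (f y) a b := by
  rw [bpol_eq]
  rfl

theorem bpol_eq_starUp (g : Field2) (k : Field3) (y : E7) (hg : 0 < (g y).det)
    (x z : Fin 7 → Fin 7 → Fin 7 → ℝ) (a b : Fin 7) :
    bpol x z (k y) a b = 6 * Real.sqrt (g y).det *
      ∑ m, ∑ n, ∑ p, ∑ q, x a m n * z b p q * starUp g k y m n p q := by
  have hs : Real.sqrt (g y).det ≠ 0 := (Real.sqrt_pos.mpr hg).ne'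
  rw [bpol_eq]
  simp only [starUp, Finset.mul_sum]
  refine Finset.sum_congr rfl fun m _ => Finset.sum_congr rfl fun n _ =>
    Finset.sum_congr rfl fun p _ => Finset.sum_congr rfl fun q _ =>
    Finset.sum_congr rfl fun r _ => Finset.sum_congr rfl fun s _ =>
    Finset.sum_congr rfl fun t _ => ?_
  field_simp

/-! ### The metric of the deformed form -/

namespace IsAdapted

variable {P A : Matrix (Fin 7) (Fin 7) ℝ} {f : Field3} {y : E7}

theorem det_metric_pos (h : IsAdapted P A f y) : 0 < (metric f y).det := by
  rw [h.det_metric]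
  exact pow_pos h.det_pos 2

theorem isAlt3 (h : IsAdapted P A f y) : IsAlt3 (f y) := by
  constructor <;> intro a b c
  · rw [h.eq_frameForm, h.eq_frameForm, frameForm, tri_swap12 isAlt3_phiR]; rfl
  · rw [h.eq_frameForm, h.eq_frameForm, frameForm, tri_swap23 isAlt3_phiR]; rfl

/-- The coefficients of s arise as (3/2)·24/144 = 1/4 = ½·½ for the linear term, 3·6/144 = 1/8 for
the quadratic and 6/144 = 1/24 for the cubic one. -/
theorem bform_add (h : IsAdapted P A f y) {k : Field3} (hk : IsAlt3 (k y)) :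
    bform (f + k) y = Real.sqrt (metric f y).det • sTensor f k y := by
  have hlin : ∀ a b, bpol (k y) (f y) (f y) a b = 24 * Real.sqrt (metric f y).det *
      ∑ m, ∑ n, k y a m n * raise23 (metric f) f y b m n := by
    intro a b
    rw [bpol_eq_starUp (metric f) f y h.det_metric_pos]
    simp only [mul_assoc, ← Finset.mul_sum]
    simp only [h.sum_mul_starUp]
    simp only [Finset.mul_sum]
    refine Finset.sum_congr rfl fun m _ => Finset.sum_congr rfl fun n _ => ?_
    ring
  have hbase : ∀ a b, (1 / 144 : ℝ) * bpol (f y) (f y) (f y) a b =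
      Real.sqrt (metric f y).det * metric f y a b := by
    intro a b
    rw [← bform_apply, h.bform_eq_sqrt_smul]
    rfl
  ext a b
  rw [bform_apply, Pi.add_apply, bpol_add_self h.isAlt3 hk, hlin, hlin,
    bpol_eq_starUp (metric f) f y h.det_metric_pos (k y) (k y),
    bpol_eq_starUp (metric f) k y h.det_metric_pos (k y) (k y)]
  simp only [Matrix.smul_apply, smul_eq_mul, sTensor, Matrix.of_apply]
  have hr : ∀ m n c, k y m n c = k y c m n := fun m n c => hk.rotate c m n
  simp only [hr, mul_add, Finset.sum_add_distrib, ← Finset.mul_sum]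
  linear_combination hbase a b

/-- B̃ equals both (det g̃)^{1/2} g̃ and (det g)^{1/2} s. -/
theorem metric_add {P' A' : Matrix (Fin 7) (Fin 7) ℝ} (h : IsAdapted P A f y) {k : Field3}
    (hk : IsAlt3 (k y)) (h' : IsAdapted P' A' (f + k) y) :
    metric (f + k) y = detRatio f k y • sTensor f k y := by
  have h1 := h'.bform_eq_sqrt_smul
  rw [h.bform_add hk] at h1
  have hs : Real.sqrt (metric (f + k) y).det ≠ 0 := (Real.sqrt_pos.mpr h'.det_metric_pos).ne'
  rw [detRatio, Real.sqrt_div h.det_metric_pos.le, div_eq_inv_mul, mul_smul, h1, smul_smul,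
    inv_mul_cancel₀ hs, one_smul]

end IsAdapted

end

section

open Matrix Filter Topology

/-! ### Partial derivatives -/

theorem pd_add {F G : E7 → ℝ} {y : E7} (hF : DifferentiableAt ℝ F y) (hG : DifferentiableAt ℝ G y)
    (a : Fin 7) : pd (fun z => F z + G z) y a = pd F y a + pd G y a := by
  simp [pd, fderiv_fun_add hF hG]

theorem pd_neg (F : E7 → ℝ) (y : E7) (a : Fin 7) : pd (fun z => -F z) y a = -pd F y a := by
  simp [pd, fderiv_fun_neg]

theorem pd_mul {F G : E7 → ℝ} {y : E7} (hF : DifferentiableAt ℝ F y) (hG : DifferentiableAt ℝ G y)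
    (a : Fin 7) : pd (fun z => F z * G z) y a = pd F y a * G y + F y * pd G y a := by
  simp only [pd, fderiv_fun_mul hF hG, _root_.add_apply, _root_.smul_apply, smul_eq_mul]
  ring

theorem pd_const_mul (c : ℝ) {F : E7 → ℝ} {y : E7} (hF : DifferentiableAt ℝ F y) (a : Fin 7) :
    pd (fun z => c * F z) y a = c * pd F y a := by
  simp [pd, fderiv_const_mul hF]

theorem pd_const (c : ℝ) (y : E7) (a : Fin 7) : pd (fun _ => c) y a = 0 := by
  simp [pd]

theorem pd_sum {ι : Type*} (s : Finset ι) {F : ι → E7 → ℝ} {y : E7}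
    (hF : ∀ i ∈ s, DifferentiableAt ℝ (F i) y) (a : Fin 7) :
    pd (fun z => ∑ i ∈ s, F i z) y a = ∑ i ∈ s, pd (F i) y a := by
  simp [pd, fderiv_fun_sum hF]

theorem pd_congr {F G : E7 → ℝ} {y : E7} (h : F =ᶠ[𝓝 y] G) (a : Fin 7) : pd F y a = pd G y a := by
  rw [pd, pd, h.fderiv_eq]

theorem pd_prod {ι : Type*} [DecidableEq ι] (s : Finset ι) {F : ι → E7 → ℝ} {y : E7}
    (hF : ∀ i ∈ s, DifferentiableAt ℝ (F i) y) (a : Fin 7) :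
    pd (fun z => ∏ i ∈ s, F i z) y a = ∑ i ∈ s, (∏ j ∈ s.erase i, F j y) * pd (F i) y a := by
  have h := (HasFDerivAt.finsetProd (u := s) fun i hi => (hF i hi).hasFDerivAt).fderiv
  rw [pd, h]
  simp [pd]

/-! ### Matrix-valued functions -/

/-- The entries of `X` are differentiable at `y`. -/
def EntryDiff (X : Field2) (y : E7) : Prop := ∀ i j, DifferentiableAt ℝ (fun z => X z i j) y

/-- The entrywise partial derivative. -/
def dmat (X : Field2) (y : E7) (a : Fin 7) : Matrix (Fin 7) (Fin 7) ℝ :=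
  Matrix.of fun i j => pd (fun z => X z i j) y a

theorem EntryDiff.mul {X Y : Field2} {y : E7} (hX : EntryDiff X y) (hY : EntryDiff Y y) :
    EntryDiff (fun z => X z * Y z) y := by
  intro i j
  simp only [Matrix.mul_apply]
  exact DifferentiableAt.fun_sum fun k _ => (hX i k).mul (hY k j)

theorem EntryDiff.transpose {X : Field2} {y : E7} (hX : EntryDiff X y) :
    EntryDiff (fun z => (X z)ᵀ) y := fun i j => hX j i

theorem EntryDiff.congr {X Y : Field2} {y : E7} (hX : EntryDiff X y) (h : Y =ᶠ[𝓝 y] X) :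
    EntryDiff Y y := fun i j =>
  (hX i j).congr_of_eventuallyEq (h.mono fun z hz => by simp only [hz])

theorem dmat_mul {X Y : Field2} {y : E7} (hX : EntryDiff X y) (hY : EntryDiff Y y) (a : Fin 7) :
    dmat (fun z => X z * Y z) y a = dmat X y a * Y y + X y * dmat Y y a := by
  ext i j
  simp only [dmat, Matrix.of_apply, Matrix.add_apply, Matrix.mul_apply]
  rw [pd_sum _ fun k _ => (hX i k).fun_mul (hY k j), ← Finset.sum_add_distrib]
  exact Finset.sum_congr rfl fun k _ => pd_mul (hX i k) (hY k j) a

theorem dmat_congr {X Y : Field2} {y : E7} (h : X =ᶠ[𝓝 y] Y) (a : Fin 7) :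
    dmat X y a = dmat Y y a := by
  ext i j
  exact pd_congr (h.mono fun z hz => by simp only [hz]) a

theorem dmat_const (C : Matrix (Fin 7) (Fin 7) ℝ) (y : E7) (a : Fin 7) :
    dmat (fun _ => C) y a = 0 := by
  ext i j
  simp [dmat, pd_const]

theorem dmat_transpose (X : Field2) (y : E7) (a : Fin 7) :
    dmat (fun z => (X z)ᵀ) y a = (dmat X y a)ᵀ := rfl

theorem pd_trace {X : Field2} {y : E7} (hX : EntryDiff X y) (a : Fin 7) :
    pd (fun z => (X z).trace) y a = (dmat X y a).trace := by
  simp only [Matrix.trace, Matrix.diag_apply]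
  rw [pd_sum _ fun k _ => hX k k]
  rfl

theorem EntryDiff.prod {X : Field2} {y : E7} (hX : EntryDiff X y) (σ : Equiv.Perm (Fin 7)) :
    DifferentiableAt ℝ (fun z => ∏ k, X z (σ k) k) y :=
  (HasFDerivAt.finsetProd (u := Finset.univ) fun k _ => (hX (σ k) k).hasFDerivAt).differentiableAt

theorem EntryDiff.det {X : Field2} {y : E7} (hX : EntryDiff X y) :
    DifferentiableAt ℝ (fun z => (X z).det) y := by
  simp only [Matrix.det_apply']
  exact DifferentiableAt.fun_sum fun σ _ => (hX.prod σ).const_mul _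

/-- Jacobi's formula for the derivative of a determinant. -/
theorem pd_det {X : Field2} {y : E7} (hX : EntryDiff X y) (a : Fin 7) :
    pd (fun z => (X z).det) y a = ((X y).adjugate * dmat X y a).trace := by
  have h1 : pd (fun z => (X z).det) y a =
      ∑ k, ((X y).updateCol k fun l => dmat X y a l k).det := by
    simp only [Matrix.det_apply']
    rw [pd_sum _ fun σ _ => (hX.prod σ).const_mul _,
      Finset.sum_comm]
    refine Finset.sum_congr rfl fun σ _ => ?_
    rw [pd_const_mul _ (hX.prod σ),
      pd_prod _ fun k _ => hX (σ k) k, Finset.mul_sum]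
    refine Finset.sum_congr rfl fun k _ => ?_
    rw [← Finset.mul_prod_erase _ _ (Finset.mem_univ k), Matrix.updateCol_self, mul_comm (dmat _ _ _ _ _)]
    congr 2
    refine Finset.prod_congr rfl fun j hj => ?_
    rw [Matrix.updateCol_ne (Finset.ne_of_mem_erase hj)]
  rw [h1, Matrix.trace]
  refine Finset.sum_congr rfl fun k _ => ?_
  rw [← Matrix.cramer_apply, Matrix.cramer_eq_adjugate_mulVec]
  rfl

theorem EntryDiff.inv {X : Field2} {y : E7} (hX : EntryDiff X y) (h0 : (X y).det ≠ 0) :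
    EntryDiff (fun z => (X z)⁻¹) y := by
  intro i j
  simp only [Matrix.inv_def, Ring.inverse_eq_inv', Matrix.smul_apply, smul_eq_mul,
    Matrix.adjugate_apply]
  refine (hX.det.inv h0).mul (EntryDiff.det fun k l => ?_)
  by_cases hk : k = j
  · subst hk
    simp
  · simpa [Matrix.updateRow_ne hk] using hX k l

theorem dmat_inv {X : Field2} {y : E7} (hX : EntryDiff X y) (h0 : (X y).det ≠ 0) (a : Fin 7) :
    dmat (fun z => (X z)⁻¹) y a = -((X y)⁻¹ * dmat X y a * (X y)⁻¹) := by
  have hu : IsUnit (X y).det := isUnit_iff_ne_zero.mpr h0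
  have h1 : (fun z => X z * (X z)⁻¹) =ᶠ[𝓝 y] fun _ => 1 := by
    filter_upwards [hX.det.continuousAt.eventually_ne h0] with z hz
    exact Matrix.mul_nonsing_inv _ (isUnit_iff_ne_zero.mpr hz)
  have h2 := dmat_congr h1 a
  rw [dmat_mul hX (hX.inv h0), dmat_const] at h2
  have h3 := congrArg (fun Z => (X y)⁻¹ * Z) h2
  simp only [Matrix.mul_add, Matrix.mul_zero, ← Matrix.mul_assoc,
    Matrix.nonsing_inv_mul _ hu, Matrix.one_mul] at h3
  exact eq_neg_of_add_eq_zero_right h3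

/-! ### The metric -/

theorem bform_symm (f : Field3) (y : E7) (a b : Fin 7) : bform f y a b = bform f y b a := by
  rw [bform_apply, bform_apply, bpol_swap]

theorem metric_symm (f : Field3) (y : E7) (a b : Fin 7) : metric f y a b = metric f y b a := by
  simp only [metric, Matrix.smul_apply, bform_symm f y a b]

theorem metric_transpose (f : Field3) (y : E7) : (metric f y)ᵀ = metric f y := by
  ext a b
  exact metric_symm f y b a

theorem metric_inv_transpose (f : Field3) (y : E7) : (metric f y)⁻¹ᵀ = (metric f y)⁻¹ := by
  rw [Matrix.transpose_nonsing_inv, metric_transpose]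

theorem entryDiff_bform {f : Field3} {y : E7}
    (hf : ∀ a b c, DifferentiableAt ℝ (fun z => f z a b c) y) : EntryDiff (bform f) y := by
  intro a b
  simp only [bform, Matrix.of_apply]
  refine DifferentiableAt.const_mul ?_ _
  refine DifferentiableAt.fun_sum fun m _ => DifferentiableAt.fun_sum fun n _ =>
    DifferentiableAt.fun_sum fun p _ => DifferentiableAt.fun_sum fun q _ =>
    DifferentiableAt.fun_sum fun r _ => DifferentiableAt.fun_sum fun s _ =>
    DifferentiableAt.fun_sum fun t _ => ?_
  exact (((hf a m n).mul (hf b p q)).mul (hf r s t)).mul_const _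

theorem entryDiff_metric {f : Field3} {y : E7}
    (hf : ∀ a b c, DifferentiableAt ℝ (fun z => f z a b c) y) (hB : 0 < (bform f y).det) :
    EntryDiff (metric f) y := by
  intro a b
  simp only [metric, Matrix.smul_apply, smul_eq_mul]
  exact ((entryDiff_bform hf).det.rpow_const (Or.inl hB.ne')).mul (entryDiff_bform hf a b)

end

section

open Matrix Filter Topology

/-! ### The Levi-Civita connection -/

/-- The matrix `Γ_a{}^e{}_b` of the Levi-Civita connection in the direction `a`. -/
def connMat (g : Field2) (y : E7) (a : Fin 7) : Matrix (Fin 7) (Fin 7) ℝ :=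
  Matrix.of fun e b => christoffel g y a e b

theorem christoffel_symm {g : Field2} (hg : ∀ z a b, g z a b = g z b a) (y : E7) (a b c : Fin 7) :
    christoffel g y a b c = christoffel g y c b a := by
  simp only [christoffel]
  congr 1
  refine Finset.sum_congr rfl fun d _ => ?_
  simp only [hg _ a c]
  ring

theorem sum_mul_christoffel {g : Field2} (hg : ∀ z a b, g z a b = g z b a) {y : E7}
    (h0 : (g y).det ≠ 0) (a b c : Fin 7) :
    ∑ e, christoffel g y a e b * g y e c = (1 / 2 : ℝ) *
      (pd (fun z => g z c a) y b + pd (fun z => g z c b) y a - pd (fun z => g z a b) y c) := by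
  have hinv : ∀ d, ∑ e, g y c e * (g y)⁻¹ e d = if c = d then 1 else 0 := by
    intro d
    rw [← Matrix.mul_apply, Matrix.mul_nonsing_inv _ (isUnit_iff_ne_zero.mpr h0), Matrix.one_apply]
  calc _ = ∑ d, (∑ e, g y c e * (g y)⁻¹ e d) * ((1 / 2 : ℝ) *
        (pd (fun z => g z d a) y b + pd (fun z => g z d b) y a - pd (fun z => g z a b) y d)) := by
        simp only [christoffel, Finset.mul_sum, Finset.sum_mul]
        rw [Finset.sum_comm]
        refine Finset.sum_congr rfl fun d _ => Finset.sum_congr rfl fun e _ => ?_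
        rw [hg y e c]
        ring
    _ = _ := by simp [hinv]

/-- Metric compatibility ∇g = 0 in matrix form. -/
theorem dmat_eq_connMat {g : Field2} (hg : ∀ z a b, g z a b = g z b a) {y : E7}
    (h0 : (g y).det ≠ 0) (a : Fin 7) :
    dmat g y a = (connMat g y a)ᵀ * g y + g y * connMat g y a := by
  ext b c
  simp only [dmat, connMat, Matrix.of_apply, Matrix.add_apply, Matrix.mul_apply,
    Matrix.transpose_apply]
  have h1 := sum_mul_christoffel hg h0 a b c
  have h2 := sum_mul_christoffel hg h0 a c b
  have h3 : ∑ e, g y b e * christoffel g y a e c = ∑ e, christoffel g y a e c * g y e b :=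
    Finset.sum_congr rfl fun e _ => by rw [hg y b e, mul_comm]
  rw [h3, h1, h2]
  simp only [hg _ c a, hg _ c b, hg _ b a]
  ring

theorem nabla2_eq (g h : Field2) (y : E7) (a b c : Fin 7) :
    nabla2 g h y a b c =
      (dmat h y a - ((connMat g y a)ᵀ * h y + h y * connMat g y a)) b c := by
  simp only [nabla2, dmat, connMat, Matrix.of_apply, Matrix.sub_apply, Matrix.add_apply,
    Matrix.mul_apply, Matrix.transpose_apply, Finset.sum_add_distrib]
  congr 2
  exact Finset.sum_congr rfl fun e _ => mul_comm _ _

/-- The change of the Levi-Civita connection in terms of the covariant derivative of the new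
metric. -/
theorem christoffel_eq_add {g g' : Field2} (hg : ∀ z a b, g z a b = g z b a)
    (hg' : ∀ z a b, g' z a b = g' z b a) {y : E7} (h0 : (g' y).det ≠ 0) (a b c : Fin 7) :
    christoffel g' y a b c = christoffel g y a b c + (1 / 2 : ℝ) * ∑ d, (g' y)⁻¹ b d *
      (nabla2 g g' y c a d + nabla2 g g' y a c d - nabla2 g g' y d a c) := by
  -- By the symmetry of Γ and g', four of the six connection terms cancel and the other two agree.
  have h1 : ∀ d, nabla2 g g' y c a d + nabla2 g g' y a c d - nabla2 g g' y d a c =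
      (pd (fun z => g' z d a) y c + pd (fun z => g' z d c) y a - pd (fun z => g' z a c) y d)
        - 2 * ∑ e, christoffel g y a e c * g' y d e := by
    intro d
    simp only [nabla2]
    have e1 : ∀ e, christoffel g y c e a = christoffel g y a e c := fun e =>
      christoffel_symm hg y c e a
    have e2 : ∀ e, christoffel g y d e a = christoffel g y a e d := fun e =>
      christoffel_symm hg y d e a
    have e3 : ∀ e, christoffel g y d e c = christoffel g y c e d := fun e =>
      christoffel_symm hg y d e c
    simp only [e1, e2, e3, Finset.sum_add_distrib, hg' _ d a, hg' _ d c]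
    have e4 : ∑ e, christoffel g y a e c * g' y e d = ∑ e, christoffel g y a e c * g' y d e :=
      Finset.sum_congr rfl fun e _ => by rw [hg' y d e]
    have e5 : ∑ e, christoffel g y a e d * g' y c e = ∑ e, christoffel g y a e d * g' y e c :=
      Finset.sum_congr rfl fun e _ => by rw [hg' y c e]
    rw [e4, e5]
    ring
  have hinv : ∀ e, ∑ d, (g' y)⁻¹ b d * g' y d e = if b = e then 1 else 0 := by
    intro e
    rw [← Matrix.mul_apply, Matrix.nonsing_inv_mul _ (isUnit_iff_ne_zero.mpr h0), Matrix.one_apply]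
  have h2 : ∑ d, (g' y)⁻¹ b d * (2 * ∑ e, christoffel g y a e c * g' y d e) =
      2 * christoffel g y a b c := by
    calc _ = 2 * ∑ e, (∑ d, (g' y)⁻¹ b d * g' y d e) * christoffel g y a e c := by
          simp only [Finset.mul_sum, Finset.sum_mul]
          rw [Finset.sum_comm]
          refine Finset.sum_congr rfl fun e _ => Finset.sum_congr rfl fun d _ => ?_
          ring
      _ = _ := by simp [hinv]
  simp only [h1, mul_sub, Finset.sum_sub_distrib]
  rw [h2, christoffel]
  simp only [mul_sub, Finset.sum_sub_distrib]
  ring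

theorem pd_det_eq {X : Field2} {y : E7} (hX : EntryDiff X y) (h0 : (X y).det ≠ 0) (a : Fin 7) :
    pd (fun z => (X z).det) y a = (X y).det * ((X y)⁻¹ * dmat X y a).trace := by
  rw [pd_det hX, Matrix.inv_def, Ring.inverse_eq_inv', Matrix.smul_mul, Matrix.trace_smul,
    smul_eq_mul, mul_inv_cancel_left₀ h0]

theorem trace_inv_mul_conn {X M : Matrix (Fin 7) (Fin 7) ℝ} (h0 : X.det ≠ 0) :
    (X⁻¹ * (Mᵀ * X + X * M)).trace = 2 * M.trace := by
  have hu : IsUnit X.det := isUnit_iff_ne_zero.mpr h0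
  rw [Matrix.mul_add, Matrix.trace_add, ← Matrix.mul_assoc, ← Matrix.mul_assoc,
    Matrix.nonsing_inv_mul _ hu, Matrix.one_mul, Matrix.trace_mul_comm, ← Matrix.mul_assoc,
    Matrix.mul_nonsing_inv _ hu, Matrix.one_mul, Matrix.trace_transpose]
  ring

/-! ### The full torsion determines the covariant derivative of the 3-form -/

/-- `f` is, near `y`, the 3-form of a differentiable `G₂`-structure. -/
structure IsG2Near (f : Field3) (y : E7) : Prop where
  differentiableAt : ∀ a b c, DifferentiableAt ℝ (fun z => f z a b c) y
  eventually : ∀ᶠ z in 𝓝 y, ∃ P A, IsAdapted P A f z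

namespace IsG2Near

variable {f : Field3} {y : E7}

theorem exists_isAdapted (h : IsG2Near f y) : ∃ P A, IsAdapted P A f y := h.eventually.self_of_nhds

theorem det_pos (h : IsG2Near f y) : 0 < (metric f y).det :=
  let ⟨_, _, hP⟩ := h.exists_isAdapted
  hP.det_metric_pos

theorem entryDiff (h : IsG2Near f y) : EntryDiff (metric f) y := by
  obtain ⟨P, A, hP⟩ := h.exists_isAdapted
  refine entryDiff_metric h.differentiableAt ?_
  rw [hP.bform_eq_sqrt_smul, Matrix.det_smul]
  exact mul_pos (pow_pos (Real.sqrt_pos.mpr hP.det_metric_pos) _) hP.det_metric_pos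

end IsG2Near

theorem isAlt3_nabla3 {g : Field2} {f : Field3} {y : E7} (hf : ∀ᶠ z in 𝓝 y, IsAlt3 (f z))
    (a : Fin 7) : IsAlt3 (nabla3 g f y a) := by
  have h0 := hf.self_of_nhds
  constructor <;> intro b c d
  · have h1 : pd (fun z => f z c b d) y a = -pd (fun z => f z b c d) y a := by
      rw [← pd_neg]
      exact pd_congr (hf.mono fun z hz => hz.swap12 b c d) a
    simp only [nabla3, h1, ← Finset.sum_neg_distrib, sub_eq_add_neg, neg_add, neg_neg]
    congr 1
    refine Finset.sum_congr rfl fun e _ => ?_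
    rw [h0.swap12 b e d, h0.swap12 e c d, h0.swap12 b c e]
    ring
  · have h1 : pd (fun z => f z b d c) y a = -pd (fun z => f z b c d) y a := by
      rw [← pd_neg]
      exact pd_congr (hf.mono fun z hz => hz.swap23 b c d) a
    simp only [nabla3, h1, ← Finset.sum_neg_distrib, sub_eq_add_neg, neg_add, neg_neg]
    congr 1
    refine Finset.sum_congr rfl fun e _ => ?_
    rw [h0.swap23 e c d, h0.swap23 b c e, h0.swap23 b e d]
    ring

theorem raise23_eq_mul (f : Field3) (y : E7) (a b c : Fin 7) :
    raise23 (metric f) f y a b c =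
      ((metric f y)⁻¹ * (Matrix.of (f y a) * (metric f y)⁻¹)) b c := by
  simp only [raise23, Matrix.mul_apply, Matrix.of_apply, Finset.mul_sum]
  refine Finset.sum_congr rfl fun m _ => Finset.sum_congr rfl fun n _ => ?_
  have : (metric f y)⁻¹ n c = (metric f y)⁻¹ c n :=
    congrFun (congrFun (metric_inv_transpose f y) c) n
  rw [this]
  ring

theorem sum_mul_eq_trace (X Y : Matrix (Fin 7) (Fin 7) ℝ) :
    ∑ m, ∑ n, X m n * Y m n = (Xᵀ * Y).trace := by
  simp only [Matrix.trace, Matrix.diag_apply, Matrix.mul_apply, Matrix.transpose_apply]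
  exact Finset.sum_comm

namespace IsG2Near

variable {f : Field3} {y : E7}

theorem isAlt3 (h : IsG2Near f y) : ∀ᶠ z in 𝓝 y, IsAlt3 (f z) :=
  h.eventually.mono fun _ ⟨_, _, hP⟩ => hP.isAlt3

/-- The covariant derivative of `φ` does not change the metric to first order. -/
theorem sum_nabla3_mul_raise23 (h : IsG2Near f y) (a b c : Fin 7) :
    (∑ m, ∑ n, nabla3 (metric f) f y a b m n * raise23 (metric f) f y c m n) +
      ∑ m, ∑ n, nabla3 (metric f) f y a c m n * raise23 (metric f) f y b m n = 0 := by
  obtain ⟨P, A, hP⟩ := h.exists_isAdapted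
  have hdet := h.det_pos.ne'
  have hu : IsUnit (metric f y).det := isUnit_iff_ne_zero.mpr hdet
  set G := (metric f y)⁻¹ with hG
  set M := connMat (metric f) y a with hM
  let F : Fin 7 → Field2 := fun b z => Matrix.of (f z b)
  let H : Fin 7 → Matrix (Fin 7) (Fin 7) ℝ := fun b => Matrix.of (nabla3 (metric f) f y a b)
  have hF : ∀ b, EntryDiff (F b) y := fun b m n => h.differentiableAt b m n
  have hGd : EntryDiff (fun z => (metric f z)⁻¹) y := h.entryDiff.inv hdet
  have hGt : Gᵀ = G := metric_inv_transpose f y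
  -- The identity φ_{bmn} φ_c^{mn} = 6 g_{bc} as a trace of matrices. It holds near y, so it can be
  -- differentiated.
  have htr : ∀ z, (∃ P A, IsAdapted P A f z) → ∀ b c,
      ((F b z)ᵀ * ((metric f z)⁻¹ * (F c z * (metric f z)⁻¹))).trace = 6 * metric f z b c := by
    rintro z ⟨P, A, hP⟩ b c
    rw [← hP.sum_mul_raise23, ← sum_mul_eq_trace]
    simp only [raise23_eq_mul]
    rfl
  have htr0 := htr y ⟨P, A, hP⟩
  have hdF : ∀ b, dmat (F b) y a = H b + (∑ e, M e b • F e y) + Mᵀ * F b y + F b y * M := by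
    intro b
    ext m n
    simp only [dmat, F, H, hM, connMat, nabla3, Matrix.of_apply, Matrix.add_apply,
      Matrix.sum_apply, Matrix.smul_apply, Matrix.mul_apply, Matrix.transpose_apply, smul_eq_mul,
      Finset.sum_add_distrib, mul_comm (f y b m _)]
    ring
  have hdG : dmat (fun z => (metric f z)⁻¹) y a = -(G * Mᵀ + M * G) := by
    rw [dmat_inv h.entryDiff hdet, dmat_eq_connMat (metric_symm f) hdet, ← hG, ← hM,
      Matrix.mul_add, Matrix.add_mul, Matrix.mul_assoc G (Mᵀ * _), Matrix.mul_assoc Mᵀ, hG,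
      Matrix.mul_nonsing_inv _ hu, Matrix.mul_one, ← Matrix.mul_assoc _ (metric f y),
      Matrix.nonsing_inv_mul _ hu, Matrix.one_mul]
  have hd : ∀ b c, pd (fun z => ((F b z)ᵀ * ((metric f z)⁻¹ *
      (F c z * (metric f z)⁻¹))).trace) y a = 6 * ∑ e, (M e b * metric f y e c +
        M e c * metric f y b e) := by
    intro b c
    have h1 : (fun z => ((F b z)ᵀ * ((metric f z)⁻¹ * (F c z * (metric f z)⁻¹))).trace) =ᶠ[𝓝 y]
        fun z => 6 * metric f z b c := h.eventually.mono fun z hz => htr z hz b c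
    rw [pd_congr h1, pd_const_mul _ (h.entryDiff b c)]
    congr 1
    have h2 := congrFun (congrFun (dmat_eq_connMat (metric_symm f) hdet a) b) c
    simp only [dmat, Matrix.of_apply, Matrix.add_apply, Matrix.mul_apply,
      Matrix.transpose_apply] at h2
    rw [h2, Finset.sum_add_distrib]
    congr 1
    exact Finset.sum_congr rfl fun e _ => mul_comm _ _
  have h2 := hd b c
  rw [pd_trace ((hF b).transpose.mul (hGd.mul ((hF c).mul hGd))),
    dmat_mul (hF b).transpose (hGd.mul ((hF c).mul hGd)), dmat_mul hGd ((hF c).mul hGd),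
    dmat_mul (hF c) hGd, dmat_transpose, hdF, hdF, hdG, ← hG] at h2
  -- The connection terms on the free indices b and c match the derivative of 6g. Those on the
  -- contracted indices cancel against the derivative of the inverse metric, by cyclicity of the
  -- trace.
  have hsum : ∑ e, (M e b * metric f y e c + M e c * metric f y b e) = (1 / 6 : ℝ) *
      (((∑ e, M e b • F e y)ᵀ * (G * (F c y * G))).trace +
        ((F b y)ᵀ * (G * ((∑ e, M e c • F e y) * G))).trace) := by
    simp only [Matrix.transpose_sum, Matrix.sum_mul, Matrix.mul_sum, Matrix.trace_sum,
      Matrix.transpose_smul, Matrix.smul_mul, Matrix.mul_smul, Matrix.trace_smul, smul_eq_mul]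
    rw [← Finset.sum_add_distrib, Finset.mul_sum]
    refine Finset.sum_congr rfl fun e _ => ?_
    rw [htr0, htr0]
    ring
  rw [hsum] at h2
  generalize (∑ e, M e b • F e y) = S₁ at h2
  generalize (∑ e, M e c • F e y) = S₂ at h2
  have e1 : ∑ m, ∑ n, nabla3 (metric f) f y a b m n * raise23 (metric f) f y c m n =
      ((H b)ᵀ * (G * (F c y * G))).trace := by
    rw [← sum_mul_eq_trace]
    simp only [raise23_eq_mul]
    rfl
  have e2 : ∑ m, ∑ n, nabla3 (metric f) f y a c m n * raise23 (metric f) f y b m n =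
      ((F b y)ᵀ * (G * (H c * G))).trace := by
    have : ((F b y)ᵀ * (G * (H c * G))).trace = ((H c)ᵀ * (G * (F b y * G))).trace := by
      rw [← Matrix.trace_transpose]
      simp only [Matrix.transpose_mul, hGt, Matrix.transpose_transpose]
      rw [Matrix.mul_assoc, Matrix.mul_assoc, Matrix.trace_mul_comm]
      simp only [Matrix.mul_assoc]
    rw [this, ← sum_mul_eq_trace]
    simp only [raise23_eq_mul]
    rfl
  rw [e1, e2]
  have e3 : (Mᵀ * ((F b y)ᵀ * (G * (F c y * G)))).trace =
      ((F b y)ᵀ * (G * (F c y * (G * Mᵀ)))).trace := by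
    rw [Matrix.trace_mul_comm]
    simp only [Matrix.mul_assoc]
  simp only [Matrix.transpose_add, Matrix.transpose_mul, Matrix.transpose_transpose,
    Matrix.add_mul, Matrix.mul_add, Matrix.neg_mul, Matrix.mul_neg, Matrix.trace_add,
    Matrix.trace_neg, Matrix.mul_assoc, e3] at h2 ⊢
  linarith

theorem nabla3_eq (h : IsG2Near f y) (a b c d : Fin 7) :
    nabla3 (metric f) f y a b c d =
      ∑ l, fullTorsion f y a l * hodgeStar (metric f) f y l b c d := by
  obtain ⟨P, A, hP⟩ := h.exists_isAdapted
  exact hP.eq_interior (isAlt3_nabla3 h.isAlt3 a) (h.sum_nabla3_mul_raise23 a) b c d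

end IsG2Near

end

section

open Matrix Filter Topology

/-! ### Deformations -/

/-- By Jacobi's formula the trace of h⁻¹ ∂h is ∂ log det h, and the connection contributes twice the
trace of Γ, which is ∂ log det g because ∇g = 0. -/
theorem sum_mul_nabla2 {g h : Field2} (hg : ∀ z a b, g z a b = g z b a)
    (hh : ∀ z a b, h z a b = h z b a) {y : E7} (hdg : EntryDiff g y) (hdh : EntryDiff h y)
    (h0 : (g y).det ≠ 0) (h1 : (h y).det ≠ 0) (a : Fin 7) :
    ∑ m, ∑ n, (h y)⁻¹ m n * nabla2 g h y a m n =
      pd (fun z => (h z).det) y a / (h y).det - pd (fun z => (g z).det) y a / (g y).det := by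
  have hht : (h y)⁻¹ᵀ = (h y)⁻¹ := by
    rw [Matrix.transpose_nonsing_inv]
    congr 1
    ext i j
    exact hh y j i
  have e1 : ∑ m, ∑ n, (h y)⁻¹ m n * nabla2 g h y a m n =
      ((h y)⁻¹ * (dmat h y a - ((connMat g y a)ᵀ * h y + h y * connMat g y a))).trace := by
    simp only [nabla2_eq]
    rw [sum_mul_eq_trace, hht]
  rw [e1, Matrix.mul_sub, Matrix.trace_sub, trace_inv_mul_conn h1, pd_det_eq hdg h0,
    pd_det_eq hdh h1, dmat_eq_connMat hg h0, trace_inv_mul_conn h0, mul_div_cancel_left₀ _ h0,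
    mul_div_cancel_left₀ _ h1]

/-- The covariant derivative of the deformed metric in terms of that of `s`, where the deformed
metric is `(det g / det g̃)^{1/2} s`. -/
theorem nabla2_deformed {f k : Field3} {y : E7} (h : IsG2Near f y) (h' : IsG2Near (f + k) y)
    (hs : ∀ᶠ z in 𝓝 y, metric (f + k) z = detRatio f k z • sTensor f k z) (e a b : Fin 7) :
    nabla2 (metric f) (metric (f + k)) y e a b = detRatio f k y *
      (nabla2 (metric f) (sTensor f k) y e a b - (1 / 9 : ℝ) * metric (f + k) y a b *
        ∑ m, ∑ n, (metric (f + k) y)⁻¹ m n * nabla2 (metric f) (sTensor f k) y e m n) := by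
  have hd := h.det_pos
  have hd' := h'.det_pos
  have hu' : IsUnit (metric (f + k) y).det := isUnit_iff_ne_zero.mpr hd'.ne'
  have hρ : ∀ z, 0 < (metric f z).det → 0 < (metric (f + k) z).det → 0 < detRatio f k z :=
    fun z h1 h2 => Real.sqrt_pos.mpr (div_pos h1 h2)
  have hρy := hρ y hd hd'
  have hpos : ∀ᶠ z in 𝓝 y, 0 < (metric f z).det ∧ 0 < (metric (f + k) z).det :=
    (h.entryDiff.det.continuousAt.eventually (lt_mem_nhds hd)).and
      (h'.entryDiff.det.continuousAt.eventually (lt_mem_nhds hd'))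
  have hρd : DifferentiableAt ℝ (detRatio f k) y := by
    have : DifferentiableAt ℝ (fun z => (metric f z).det / (metric (f + k) z).det) y := by
      simp only [div_eq_mul_inv]
      exact h.entryDiff.det.mul (h'.entryDiff.det.inv hd'.ne')
    exact this.sqrt (div_pos hd hd').ne'
  -- Differentiability of s is read off from s = ρ⁻¹ g̃ near y, not from its defining formula.
  have hsd : EntryDiff (sTensor f k) y := by
    intro i j
    have h1 : (fun z => sTensor f k z i j) =ᶠ[𝓝 y]
        fun z => (detRatio f k z)⁻¹ * metric (f + k) z i j := by
      filter_upwards [hs, hpos] with z hz hz2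
      rw [hz, Matrix.smul_apply, smul_eq_mul, inv_mul_cancel_left₀ (hρ z hz2.1 hz2.2).ne']
    exact ((hρd.inv hρy.ne').mul (h'.entryDiff i j)).congr_of_eventuallyEq h1
  have hsy : ∀ i j, metric (f + k) y i j = detRatio f k y * sTensor f k y i j := fun i j => by
    rw [hs.self_of_nhds]
    rfl
  have hpd : ∀ i j, pd (fun z => metric (f + k) z i j) y e =
      pd (detRatio f k) y e * sTensor f k y i j +
        detRatio f k y * pd (fun z => sTensor f k z i j) y e := by
    intro i j
    rw [← pd_mul hρd (hsd i j)]
    exact pd_congr (hs.mono fun z hz => by rw [hz]; rfl) e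
  have hnab : ∀ i j, nabla2 (metric f) (metric (f + k)) y e i j =
      pd (detRatio f k) y e / detRatio f k y * metric (f + k) y i j +
        detRatio f k y * nabla2 (metric f) (sTensor f k) y e i j := by
    intro i j
    simp only [nabla2, hpd, hsy]
    rw [mul_sub, Finset.mul_sum]
    have : ∀ x, detRatio f k y * (christoffel (metric f) y e x i * sTensor f k y x j +
        christoffel (metric f) y e x j * sTensor f k y i x) =
        christoffel (metric f) y e x i * (detRatio f k y * sTensor f k y x j) +
        christoffel (metric f) y e x j * (detRatio f k y * sTensor f k y i x) := fun x => by ring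
    simp only [this]
    field_simp
    ring
  have htr := sum_mul_nabla2 (metric_symm f) (metric_symm (f + k)) h.entryDiff h'.entryDiff
    hd.ne' hd'.ne' e
  have h7 : ∑ m, ∑ n, (metric (f + k) y)⁻¹ m n * metric (f + k) y m n = 7 := by
    rw [sum_mul_eq_trace, metric_inv_transpose, Matrix.nonsing_inv_mul _ hu', Matrix.trace_one]
    simp
  have hsplit : ∑ m, ∑ n, (metric (f + k) y)⁻¹ m n * nabla2 (metric f) (metric (f + k)) y e m n =
      pd (detRatio f k) y e / detRatio f k y * 7 + detRatio f k y *
        ∑ m, ∑ n, (metric (f + k) y)⁻¹ m n * nabla2 (metric f) (sTensor f k) y e m n := by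
    rw [← h7]
    simp only [hnab, mul_add, Finset.sum_add_distrib, Finset.mul_sum]
    congr 1 <;> refine Finset.sum_congr rfl fun m _ => Finset.sum_congr rfl fun n _ => ?_ <;> ring
  have hsq : ∀ z, 0 < (metric f z).det → 0 < (metric (f + k) z).det →
      detRatio f k z * detRatio f k z * (metric (f + k) z).det = (metric f z).det := by
    intro z h1 h2
    rw [detRatio, Real.mul_self_sqrt (div_pos h1 h2).le, div_mul_cancel₀ _ h2.ne']
  have hlog : 2 * (pd (detRatio f k) y e / detRatio f k y) =
      pd (fun z => (metric f z).det) y e / (metric f y).det -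
        pd (fun z => (metric (f + k) z).det) y e / (metric (f + k) y).det := by
    have h1 : pd (fun z => (metric f z).det) y e =
        pd (fun z => detRatio f k z * detRatio f k z * (metric (f + k) z).det) y e :=
      pd_congr (hpos.mono fun z hz => (hsq z hz.1 hz.2).symm) e
    rw [pd_mul (hρd.fun_mul hρd) h'.entryDiff.det, pd_mul hρd hρd] at h1
    rw [h1, ← hsq y hd hd']
    have := hd'.ne'
    field_simp
    ring
  rw [hsplit] at htr
  -- Two expressions for g̃^{mn} ∇_e g̃_{mn}: g̃ = ρ s gives 7 ∂ log ρ + ρ g̃^{mn} ∇_e s_{mn}, and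
  -- ρ² = det g / det g̃ gives -2 ∂ log ρ. Hence the 9 = 7 + 2.
  have hfin : pd (detRatio f k) y e / detRatio f k y = -(1 / 9 : ℝ) * (detRatio f k y *
      ∑ m, ∑ n, (metric (f + k) y)⁻¹ m n * nabla2 (metric f) (sTensor f k) y e m n) := by
    linarith
  rw [hnab, hfin]
  ring

theorem christoffel_deformed {f k : Field3} {y : E7} (h : IsG2Near f y) (h' : IsG2Near (f + k) y)
    (hs : ∀ᶠ z in 𝓝 y, metric (f + k) z = detRatio f k z • sTensor f k z) (a b c : Fin 7) :
    christoffel (metric (f + k)) y a b c =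
      christoffel (metric f) y a b c + deltaGamma f k y a b c := by
  have hu' : IsUnit (metric (f + k) y).det := isUnit_iff_ne_zero.mpr h'.det_pos.ne'
  rw [christoffel_eq_add (metric_symm f) (metric_symm (f + k)) h'.det_pos.ne', deltaGamma]
  congr 1
  simp only [nabla2_deformed h h' hs]
  obtain ⟨τ, hτ⟩ : ∃ τ : Fin 7 → ℝ, ∀ e, ∑ m, ∑ n, (metric (f + k) y)⁻¹ m n *
    nabla2 (metric f) (sTensor f k) y e m n = τ e := ⟨_, fun _ => rfl⟩
  simp only [hτ]
  have hinv : ∀ c, ∑ d, (metric (f + k) y)⁻¹ b d * metric (f + k) y c d = kron c b := by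
    intro c
    simp only [metric_symm (f + k) y c]
    rw [← Matrix.mul_apply, Matrix.nonsing_inv_mul _ hu', Matrix.one_apply, kron]
    simp only [eq_comm]
  have h1 : ∀ d, (metric (f + k) y)⁻¹ b d *
      (detRatio f k y * (nabla2 (metric f) (sTensor f k) y c a d -
          1 / 9 * metric (f + k) y a d * τ c) +
        detRatio f k y * (nabla2 (metric f) (sTensor f k) y a c d -
          1 / 9 * metric (f + k) y c d * τ a) -
        detRatio f k y * (nabla2 (metric f) (sTensor f k) y d a c -
          1 / 9 * metric (f + k) y a c * τ d)) =
      detRatio f k y * ((metric (f + k) y)⁻¹ b d * (nabla2 (metric f) (sTensor f k) y c a d +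
        nabla2 (metric f) (sTensor f k) y a c d - nabla2 (metric f) (sTensor f k) y d a c))
      - detRatio f k y * (1 / 9) * τ c * ((metric (f + k) y)⁻¹ b d * metric (f + k) y a d)
      - detRatio f k y * (1 / 9) * τ a * ((metric (f + k) y)⁻¹ b d * metric (f + k) y c d)
      + detRatio f k y * (1 / 9) * (metric (f + k) y a c * (metric (f + k) y)⁻¹ b d * τ d) := by
    intro d
    ring
  simp only [h1, Finset.sum_add_distrib, Finset.sum_sub_distrib, ← Finset.mul_sum, hinv]
  have h2 : ∑ e, (kron a b * kron c e + kron c b * kron a e -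
      metric (f + k) y a c * (metric (f + k) y)⁻¹ b e) * τ e =
      kron a b * τ c + kron c b * τ a -
        ∑ e, metric (f + k) y a c * (metric (f + k) y)⁻¹ b e * τ e := by
    simp only [sub_mul, add_mul, Finset.sum_add_distrib, Finset.sum_sub_distrib, mul_assoc,
      ← Finset.mul_sum]
    simp [kron]
  rw [h2]
  ring

/-! ### Transformation of the torsion -/

theorem isAlt3_starUp (g : Field2) (f : Field3) (y : E7) (m : Fin 7) : IsAlt3 (starUp g f y m) := by
  have h1 : ∀ b c d r s t, eps ![m, c, b, d, r, s, t] = -eps ![m, b, c, d, r, s, t] := by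
    intro b c d r s t
    have := eps_comp_perm ![m, b, c, d, r, s, t] (Equiv.swap 1 2)
    rw [Equiv.Perm.sign_swap (by decide)] at this
    simp only [Units.val_neg, Units.val_one, Int.cast_neg, Int.cast_one, neg_mul, one_mul] at this
    rw [← this]
    congr 1
    ext x
    fin_cases x <;> rfl
  have h2 : ∀ b c d r s t, eps ![m, b, d, c, r, s, t] = -eps ![m, b, c, d, r, s, t] := by
    intro b c d r s t
    have := eps_comp_perm ![m, b, c, d, r, s, t] (Equiv.swap 2 3)
    rw [Equiv.Perm.sign_swap (by decide)] at this
    simp only [Units.val_neg, Units.val_one, Int.cast_neg, Int.cast_one, neg_mul, one_mul] at this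
    rw [← this]
    congr 1
    ext x
    fin_cases x <;> rfl
  constructor <;> intro b c d
  · simp only [starUp, h1 b c d, neg_mul, Finset.sum_neg_distrib, mul_neg]
  · simp only [starUp, h2 b c d, neg_mul, Finset.sum_neg_distrib, mul_neg]

/-- The components `∇_a f_{bcd}` for two connections with difference `δ`. -/
theorem nabla3_eq_sub {g g' : Field2} {y : E7} {δ : Fin 7 → Fin 7 → Fin 7 → ℝ}
    (hδ : ∀ a b c, christoffel g' y a b c = christoffel g y a b c + δ a b c) (f : Field3)
    (a b c d : Fin 7) :
    nabla3 g' f y a b c d = nabla3 g f y a b c d -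
      ∑ e, (δ a e b * f y e c d + δ a e c * f y b e d + δ a e d * f y b c e) := by
  simp only [nabla3, hδ, sub_sub, ← Finset.sum_add_distrib]
  congr 1
  refine Finset.sum_congr rfl fun e _ => ?_
  ring

theorem nabla3_add {g : Field2} {f k : Field3} {y : E7}
    (hf : ∀ a b c, DifferentiableAt ℝ (fun z => f z a b c) y)
    (hk : ∀ a b c, DifferentiableAt ℝ (fun z => k z a b c) y) (a b c d : Fin 7) :
    nabla3 g (f + k) y a b c d = nabla3 g f y a b c d + nabla3 g k y a b c d := by
  simp only [nabla3, Pi.add_apply]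
  rw [pd_add (hf b c d) (hk b c d), sub_add_sub_comm, ← Finset.sum_add_distrib]
  congr 1
  refine Finset.sum_congr rfl fun e _ => ?_
  ring

/-- Contracted with an alternating S, the action of D on each of the three slots of t contributes
the same amount. -/
theorem sum_rotate_mul {D : Fin 7 → Fin 7 → ℝ} {t S : Fin 7 → Fin 7 → Fin 7 → ℝ}
    (ht : IsAlt3 t) (hS : IsAlt3 S) :
    ∑ b, ∑ c, ∑ d, (∑ e, (D e b * t e c d + D e c * t b e d + D e d * t b c e)) * S b c d =
      3 * ∑ e, ∑ b, D e b * ∑ c, ∑ d, t e c d * S b c d := by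
  have h0 : ∑ e, ∑ b, D e b * ∑ c, ∑ d, t e c d * S b c d =
      ∑ b, ∑ c, ∑ d, ∑ e, D e b * t e c d * S b c d := by
    simp only [Finset.mul_sum]
    rw [sum_comm_one_three]
    refine Finset.sum_congr rfl fun b _ => Finset.sum_congr rfl fun c _ =>
      Finset.sum_congr rfl fun d _ => Finset.sum_congr rfl fun e _ => ?_
    ring
  have h1 : ∑ b, ∑ c, ∑ d, ∑ e, D e c * t b e d * S b c d =
      ∑ b, ∑ c, ∑ d, ∑ e, D e b * t e c d * S b c d := by
    rw [Finset.sum_comm]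
    refine Finset.sum_congr rfl fun b _ => Finset.sum_congr rfl fun c _ =>
      Finset.sum_congr rfl fun d _ => Finset.sum_congr rfl fun e _ => ?_
    rw [ht.swap12 e c d, hS.swap12 b c d]
    ring
  have h2 : ∑ b, ∑ c, ∑ d, ∑ e, D e d * t b c e * S b c d =
      ∑ b, ∑ c, ∑ d, ∑ e, D e b * t e c d * S b c d := by
    rw [sum_comm_one_two fun b c d => ∑ e, D e b * t e c d * S b c d]
    refine Finset.sum_congr rfl fun b _ => Finset.sum_congr rfl fun c _ =>
      Finset.sum_congr rfl fun d _ => Finset.sum_congr rfl fun e _ => ?_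
    rw [ht.rotate e b c, hS.rotate d b c]
  simp only [Finset.sum_mul, add_mul, Finset.sum_add_distrib]
  rw [h0, h1, h2]
  ring

/-- With all indices raised, the star is linear in the form and involves the metric only through
(det g)^{-1/2}. -/
theorem starUp_deformed {f k : Field3} {y : E7} (hd : 0 < (metric f y).det)
    (m n p q : Fin 7) :
    starUp (metric (f + k)) (f + k) y m n p q =
      detRatio f k y * (starUp (metric f) f y m n p q + starUp (metric f) k y m n p q) := by
  have hs : Real.sqrt (metric f y).det ≠ 0 := (Real.sqrt_pos.mpr hd).ne'
  simp only [starUp, detRatio, Real.sqrt_div hd.le, Pi.add_apply, mul_add, Finset.sum_add_distrib]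
  field_simp

theorem fullTorsion_deformed {f k : Field3} {y : E7} (h : IsG2Near f y)
    (h' : IsG2Near (f + k) y) (hk : ∀ a b c, DifferentiableAt ℝ (fun z => k z a b c) y)
    (hδ : ∀ a b c, christoffel (metric (f + k)) y a b c =
      christoffel (metric f) y a b c + deltaGamma f k y a b c) (a m : Fin 7) :
    fullTorsion (f + k) y a m = detRatio f k y *
        (fullTorsion f y a m
          + (1 / 24 : ℝ) * ∑ l, ∑ b, ∑ c, ∑ d,
              fullTorsion f y a l * hodgeStar (metric f) f y l b c d * starUp (metric f) k y m b c d
          + (1 / 24 : ℝ) * ∑ b, ∑ c, ∑ d,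
              starUp (metric f) f y m b c d * nabla3 (metric f) k y a b c d
          + (1 / 24 : ℝ) * ∑ b, ∑ c, ∑ d,
              nabla3 (metric f) k y a b c d * starUp (metric f) k y m b c d)
        - (1 / 2 : ℝ) * ∑ l, ∑ b, deltaGamma f k y a l b *
            raise23 (metric (f + k)) (f + k) y l m b := by
  obtain ⟨P', A', hP'⟩ := h'.exists_isAdapted
  -- The 12 is 3 equal slots times the 4 of φ̃·ψ̃ = 4φ̃.
  have h1 : ∑ b, ∑ c, ∑ d, (∑ e, (deltaGamma f k y a e b * (f + k) y e c d +
      deltaGamma f k y a e c * (f + k) y b e d + deltaGamma f k y a e d * (f + k) y b c e)) *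
      starUp (metric (f + k)) (f + k) y m b c d =
      12 * ∑ l, ∑ b, deltaGamma f k y a l b * raise23 (metric (f + k)) (f + k) y l m b := by
    rw [sum_rotate_mul hP'.isAlt3 (isAlt3_starUp _ _ _ m)]
    simp only [hP'.sum_mul_starUp, mul_left_comm _ (4 : ℝ), ← Finset.mul_sum]
    ring
  -- Claim 1 for the undeformed structure turns T·ψ back into ∇φ.
  have h2 : ∑ l, ∑ b, ∑ c, ∑ d, fullTorsion f y a l * hodgeStar (metric f) f y l b c d *
      starUp (metric f) k y m b c d =
      ∑ b, ∑ c, ∑ d, nabla3 (metric f) f y a b c d * starUp (metric f) k y m b c d := by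
    rw [sum_comm_one_three]
    simp only [← Finset.sum_mul, ← h.nabla3_eq]
  have h3 : fullTorsion (f + k) y a m = (1 / 24 : ℝ) * ((∑ b, ∑ c, ∑ d,
      (nabla3 (metric f) f y a b c d + nabla3 (metric f) k y a b c d) *
        (detRatio f k y * (starUp (metric f) f y m b c d + starUp (metric f) k y m b c d))) -
      12 * ∑ l, ∑ b, deltaGamma f k y a l b * raise23 (metric (f + k)) (f + k) y l m b) := by
    rw [← h1, fullTorsion]
    simp only [← Finset.sum_sub_distrib, ← starUp_deformed h.det_pos, ← sub_mul]
    congr 1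
    refine Finset.sum_congr rfl fun b _ => Finset.sum_congr rfl fun c _ =>
      Finset.sum_congr rfl fun d _ => ?_
    rw [nabla3_eq_sub hδ, nabla3_add h.differentiableAt hk]
  have h4 : ∀ b c d, (nabla3 (metric f) f y a b c d + nabla3 (metric f) k y a b c d) *
        (detRatio f k y * (starUp (metric f) f y m b c d + starUp (metric f) k y m b c d)) =
      detRatio f k y * (nabla3 (metric f) f y a b c d * starUp (metric f) f y m b c d +
        nabla3 (metric f) f y a b c d * starUp (metric f) k y m b c d +
        starUp (metric f) f y m b c d * nabla3 (metric f) k y a b c d +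
        nabla3 (metric f) k y a b c d * starUp (metric f) k y m b c d) := by
    intros
    ring
  rw [h3, h2, fullTorsion]
  simp only [h4, ← Finset.mul_sum, Finset.sum_add_distrib]
  ring

/-! ### Components in charts -/

section Manifold

variable {M : Type*} [TopologicalSpace M] [ChartedSpace E7 M]

theorem isAlt3_comps (e : OpenPartialHomeomorph M E7) (φ : ThreeForm M) (y : E7) :
    IsAlt3 (comps e φ y) := by
  constructor <;> intro a b c
  · have := (φ (e.symm y)).map_swap ![coordVec e y a, coordVec e y b, coordVec e y c]
      (i := 0) (j := 1) (by decide)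
    rw [comps, comps, ← this]
    congr 1
    ext x
    fin_cases x <;> rfl
  · have := (φ (e.symm y)).map_swap ![coordVec e y a, coordVec e y b, coordVec e y c]
      (i := 1) (j := 2) (by decide)
    rw [comps, comps, ← this]
    congr 1
    ext x
    fin_cases x <;> rfl

theorem comps_add (e : OpenPartialHomeomorph M E7) (φ χ : ThreeForm M) :
    comps e (φ + χ) = comps e φ + comps e χ := rfl

theorem IsG2Structure.isG2Near {A : Set (OpenPartialHomeomorph M E7)} {φ : ThreeForm M}
    (hφ : IsG2Structure A φ) {e : OpenPartialHomeomorph M E7} (he : e ∈ A) {y : E7}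
    (hy : y ∈ e.target) : IsG2Near (comps e φ) y := by
  have hn : e.target ∈ 𝓝 y := e.open_target.mem_nhds hy
  refine ⟨fun a b c => ?_, ?_⟩
  · exact ((hφ.smooth e he a b c).contDiffAt hn).differentiableAt (by simp)
  · filter_upwards [hn] with z hz
    obtain ⟨L, hL⟩ := hφ.positive (e.symm z)
    refine exists_isAdapted (fun a => L (coordVec e z a)) (fun a b c => ?_)
      (hφ.oriented e he z hz)
    rw [comps, hL, AlternatingMap.compLinearMap_apply]
    congr 1
    ext x
    fin_cases x <;> rfl

end Manifold

end

end G2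

end

theorem mainTheorem9 {M : Type*} [TopologicalSpace M] [ChartedSpace E7 M]
    [IsManifold (𝓡 7) ∞ M]
    (A : Set (OpenPartialHomeomorph M E7)) (hA : IsOrientedAtlas A)
    (φ χ : ThreeForm M) (hφ : IsG2Structure A φ) (hφχ : IsG2Structure A (φ + χ))
    (e : OpenPartialHomeomorph M E7) (he : e ∈ A) (f k f' : Field3)
    (hf : f = comps e φ) (hk : k = comps e χ) (hf' : f' = comps e (φ + χ))
    (y : E7) (hy : y ∈ e.target) :
    -- the tensor `T̃` is the full torsion of `φ̃`: `∇̃_a φ̃_{bcd} = T̃_a^e ψ̃_{ebcd}`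
    (∀ a b c d, nabla3 (metric f') f' y a b c d =
      ∑ l, fullTorsion f' y a l * hodgeStar (metric f') f' y l b c d) ∧
    -- `δΓ` is the difference of the Levi-Civita connections
    (∀ a b c, christoffel (metric f') y a b c =
      christoffel (metric f) y a b c + deltaGamma f k y a b c) ∧
    -- the formula for `T̃`
    (∀ a m, fullTorsion f' y a m =
      Real.sqrt ((metric f y).det / (metric f' y).det) *
        (fullTorsion f y a m
          + (1 / 24 : ℝ) * ∑ l, ∑ b, ∑ c, ∑ d,
              fullTorsion f y a l * hodgeStar (metric f) f y l b c d * starUp (metric f) k y m b c d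
          + (1 / 24 : ℝ) * ∑ b, ∑ c, ∑ d,
              starUp (metric f) f y m b c d * nabla3 (metric f) k y a b c d
          + (1 / 24 : ℝ) * ∑ b, ∑ c, ∑ d,
              nabla3 (metric f) k y a b c d * starUp (metric f) k y m b c d)
        - (1 / 2 : ℝ) * ∑ l, ∑ b, deltaGamma f k y a l b * raise23 (metric f') f' y l m b) := by
  obtain rfl : f' = f + k := by rw [hf', hf, hk, comps_add]
  have h1 : ∀ z ∈ e.target, IsG2Near f z := fun z hz => hf ▸ hφ.isG2Near he hz
  have h2 : ∀ z ∈ e.target, IsG2Near (f + k) z := fun z hz => hf' ▸ hφχ.isG2Near he hz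
  -- The relation g̃ = ρ s is needed on a neighbourhood, because it is differentiated at y.
  have hs : ∀ᶠ z in nhds y, metric (f + k) z = detRatio f k z • sTensor f k z := by
    filter_upwards [e.open_target.mem_nhds hy] with z hz
    obtain ⟨P, A, hP⟩ := (h1 z hz).exists_isAdapted
    obtain ⟨P', A', hP'⟩ := (h2 z hz).exists_isAdapted
    exact hP.metric_add (hk ▸ isAlt3_comps e χ z) hP'
  -- χ is differentiable as the difference of the two smooth forms φ + χ and φ.
  have hkd : ∀ a b c, DifferentiableAt ℝ (fun z => k z a b c) y := by
    intro a b c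
    have := ((h2 y hy).differentiableAt a b c).sub ((h1 y hy).differentiableAt a b c)
    refine this.congr_of_eventuallyEq (Filter.Eventually.of_forall fun z => ?_)
    simp
  have hδ := christoffel_deformed (h1 y hy) (h2 y hy) hs
  exact ⟨(h2 y hy).nabla3_eq, hδ, fullTorsion_deformed (h1 y hy) (h2 y hy) hkd hδ⟩
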